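/- Let $1<p<\infty$. The Hardy space is $H^p=\{u\in L^p(\mathbb T):\hat u(n)=0\text{ for all }n<0\}$, with the $L^p(\mathbb T)$-norm; $P_+:L^p(\mathbb T)\to H^p$, $\sum_{n\in\mathbb Z}\hat f(n)e^{in\theta}\mapsto\sum_{n\ge 0}\hat f(n)e^{in\theta}$, is the Riesz projection; and for $F\in L^\infty(\mathbb T)$ the Toeplitz operator $T_F$ on $H^p$ is $T_Fu=P_+(Fu)$. A bounded operator $T$ on a Banach space $X$ is hypercyclic if there is $x\in X$ whose orbit $\{T^nx:n\ge 0\}$ is dense in $X$. Theorem. Let $1<p<\infty$, let $a,b,c\in\mathbb C$ with $|a|\ne|c|$, and let $F(e^{i\theta})=ae^{-i\theta}+b+ce^{i\theta}$. Then the following are equivalent: (1) $T_F$ is hypercyclic on $H^p$; (2) $|a|>|c|$ and $\mathcal E\cap\mathbb T\neq\varnothing$, where $\mathbb T$ is the unit circle and $\mathcal E$ is the interior of the (non-degenerate) elliptic curve $F(\mathbb T)$, that is, the bounded connected component of $\mathbb C\setminus F(\mathbb T)$. -/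

import Mathlib

open MeasureTheory AddCircle
open scoped ENNReal Real

namespace HardyToeplitz

instance factTwoPiPos : Fact ((0 : ℝ) < 2 * π) := ⟨Real.two_pi_pos⟩

/-- The circle `ℝ / 2πℤ`; the class of `θ` stands for the point `e^{iθ}` of the unit circle, and
`fourier n` is the function `e^{iθ} ↦ e^{inθ}`. -/
abbrev Torus : Type := AddCircle (2 * π)

/-- Normalised Lebesgue measure `dθ / 2π` on the circle. -/
noncomputable abbrev normLeb : Measure Torus := haarAddCircle

lemma integrable_of_Lp (p : ℝ≥0∞) [hp : Fact (1 ≤ p)] (f : Lp ℂ p normLeb) :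
    Integrable f normLeb :=
  (Lp.memLp f).integrable hp.out

lemma fourierCoeff_Lp_add (p : ℝ≥0∞) [Fact (1 ≤ p)] (f g : Lp ℂ p normLeb) (n : ℤ) :
    fourierCoeff (f + g : Lp ℂ p normLeb) n = fourierCoeff f n + fourierCoeff g n := by
  rw [fourierCoeff_congr_ae (Lp.coeFn_add f g),
    fourierCoeff.add (integrable_of_Lp p f) (integrable_of_Lp p g)]
  rfl

lemma fourierCoeff_Lp_smul (p : ℝ≥0∞) (c : ℂ) (f : Lp ℂ p normLeb) (n : ℤ) :
    fourierCoeff (c • f : Lp ℂ p normLeb) n = c * fourierCoeff f n := by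
  rw [fourierCoeff_congr_ae (Lp.coeFn_smul c f), fourierCoeff.const_smul]
  rfl

lemma fourierCoeff_Lp_zero (p : ℝ≥0∞) (n : ℤ) :
    fourierCoeff (0 : Lp ℂ p normLeb) n = 0 := by
  have := fourierCoeff_Lp_smul p 0 0 n
  simpa using this

/-- The `n`-th Fourier coefficient, as a continuous linear functional on `L^p`. -/
noncomputable def coeffL (p : ℝ≥0∞) [hp : Fact (1 ≤ p)] (n : ℤ) : Lp ℂ p normLeb →L[ℂ] ℂ :=
  LinearMap.mkContinuous
    { toFun := fun f => fourierCoeff f n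
      map_add' := fun f g => fourierCoeff_Lp_add p f g n
      map_smul' := fun c f => fourierCoeff_Lp_smul p c f n } 1 (by
    intro f
    have h1 : ‖fourierCoeff f n‖ ≤ ∫ t, ‖f t‖ ∂normLeb := by
      refine (norm_integral_le_integral_norm _).trans (le_of_eq ?_)
      refine integral_congr_ae (Filter.Eventually.of_forall fun t => ?_)
      beta_reduce
      rw [norm_smul, fourier_apply, Circle.norm_coe, one_mul]
    have h2 : ∫ t, ‖f t‖ ∂normLeb ≤ ‖f‖ := by
      rw [integral_norm_eq_lintegral_enorm (Lp.aestronglyMeasurable f), Lp.norm_def,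
        ← eLpNorm_one_eq_lintegral_enorm]
      exact ENNReal.toReal_mono (Lp.eLpNorm_ne_top f)
        (eLpNorm_le_eLpNorm_of_exponent_le hp.out (Lp.aestronglyMeasurable f))
    simpa using h1.trans h2)

@[simp] lemma coeffL_apply (p : ℝ≥0∞) [Fact (1 ≤ p)] (n : ℤ) (f : Lp ℂ p normLeb) :
    coeffL p n f = fourierCoeff f n := rfl

/-- An integrable function all of whose Fourier coefficients vanish is zero almost everywhere. -/
lemma ae_zero_of_fourierCoeff {f : Torus → ℂ} (hf : Integrable f normLeb)
    (h : ∀ n, fourierCoeff f n = 0) : f =ᵐ[normLeb] 0 := by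
  have hgi : ∀ g : C(Torus, ℂ), Integrable (fun t => g t * f t) normLeb := fun g =>
    hf.bdd_mul (c := ‖g‖) g.continuous.aestronglyMeasurable
      (Filter.Eventually.of_forall fun t => g.norm_coe_le_norm t)
  let Φ : C(Torus, ℂ) →L[ℂ] ℂ := LinearMap.mkContinuous
    { toFun := fun g => ∫ t, g t * f t ∂normLeb
      map_add' := fun g k => by
        rw [← integral_add (hgi g) (hgi k)]
        simp [add_mul]
      map_smul' := fun r g => by
        rw [RingHom.id_apply, smul_eq_mul, ← integral_const_mul]
        simp [mul_assoc] } (∫ t, ‖f t‖ ∂normLeb) (by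
    intro g
    refine (norm_integral_le_integral_norm _).trans ?_
    rw [mul_comm (∫ t, ‖f t‖ ∂normLeb) ‖g‖, ← integral_const_mul]
    refine integral_mono (hgi g).norm (hf.norm.const_mul _) fun t => ?_
    simp only [norm_mul]
    gcongr
    exact g.norm_coe_le_norm t)
  have hΦ : ∀ g : C(Torus, ℂ), ∫ t, g t * f t ∂normLeb = 0 := by
    intro g
    have hle : (Submodule.span ℂ (Set.range (@fourier (2 * π)))).topologicalClosure ≤
        LinearMap.ker (Φ : C(Torus, ℂ) →ₗ[ℂ] ℂ) := by
      refine Submodule.topologicalClosure_minimal _ ?_ Φ.isClosed_ker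
      rw [Submodule.span_le]
      rintro _ ⟨n, rfl⟩
      have := h (-n)
      simp only [fourierCoeff, neg_neg, smul_eq_mul] at this
      exact this
    rw [span_fourier_closure_eq_top] at hle
    exact hle (Submodule.mem_top : g ∈ ⊤)
  refine ae_eq_zero_of_forall_setIntegral_isClosed_eq_zero hf fun s hs => ?_
  rw [← integral_indicator hs.measurableSet]
  have hlim := tendsto_integral_of_dominated_convergence (μ := normLeb)
    (F := fun n t => (((hs.apprSeq n t : NNReal) : ℝ) : ℂ) * f t) (f := s.indicator f)
    (fun t => ‖f t‖) (fun n => by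
      refine AEStronglyMeasurable.mul ?_ hf.aestronglyMeasurable
      refine Continuous.aestronglyMeasurable ?_
      have := (hs.apprSeq n).continuous
      fun_prop) hf.norm
    (fun n => Filter.Eventually.of_forall fun t => by
      have h1 : ((hs.apprSeq n t : NNReal) : ℝ) ≤ 1 := by
        exact_mod_cast HasOuterApproxClosed.apprSeq_apply_le_one hs n t
      rw [norm_mul, Complex.norm_real, Real.norm_of_nonneg (NNReal.coe_nonneg _)]
      exact mul_le_of_le_one_left (norm_nonneg _) h1)
    (Filter.Eventually.of_forall fun t => by
      have h1 := (tendsto_pi_nhds.1 (HasOuterApproxClosed.tendsto_apprSeq hs)) t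
      have h2 : Filter.Tendsto (fun n => (((hs.apprSeq n t : NNReal) : ℝ) : ℂ)) Filter.atTop
          (nhds (((s.indicator (fun _ => (1 : NNReal)) t : NNReal) : ℝ) : ℂ)) :=
        ((Complex.continuous_ofReal.comp NNReal.continuous_coe).tendsto _).comp h1
      have h3 := h2.mul_const (f t)
      convert h3 using 2
      by_cases ht : t ∈ s <;> simp [ht])
  have hz : ∀ n, ∫ t, (((hs.apprSeq n t : NNReal) : ℝ) : ℂ) * f t ∂normLeb = 0 := fun n =>
    hΦ ⟨fun t => (((hs.apprSeq n t : NNReal) : ℝ) : ℂ), by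
      have := (hs.apprSeq n).continuous
      fun_prop⟩
  simp only [hz] at hlim
  exact (tendsto_nhds_unique hlim tendsto_const_nhds)

/-- The Hardy space `H^p`: the functions `u ∈ L^p(𝕋)` with `û(n) = 0` for all `n < 0`, with the norm
of `L^p(𝕋)`. -/
noncomputable def hardySpace (p : ℝ≥0∞) [Fact (1 ≤ p)] : Submodule ℂ (Lp ℂ p normLeb) where
  carrier := {u | ∀ n : ℤ, n < 0 → fourierCoeff u n = 0}
  zero_mem' := fun n _ => fourierCoeff_Lp_zero p n
  add_mem' := fun {u v} hu hv n hn => by rw [fourierCoeff_Lp_add, hu n hn, hv n hn, add_zero]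
  smul_mem' := fun c u hu n hn => by rw [fourierCoeff_Lp_smul, hu n hn, mul_zero]

/-- `g = P₊ f`: the function `g ∈ H^p` has the same Fourier coefficients of index `n ≥ 0` as `f`. -/
def IsRieszProjection (p : ℝ≥0∞) [Fact (1 ≤ p)] (f : Lp ℂ p normLeb) (g : hardySpace p) : Prop :=
  ∀ n : ℤ, 0 ≤ n → fourierCoeff (g : Lp ℂ p normLeb) n = fourierCoeff f n

lemma IsRieszProjection.unique {p : ℝ≥0∞} [Fact (1 ≤ p)] {f : Lp ℂ p normLeb} {g h : hardySpace p}
    (hg : IsRieszProjection p f g) (hh : IsRieszProjection p f h) : g = h := by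
  have key : ((g - h : hardySpace p) : Lp ℂ p normLeb) = 0 := by
    rw [Lp.eq_zero_iff_ae_eq_zero]
    refine ae_zero_of_fourierCoeff (integrable_of_Lp p _) fun n => ?_
    have h1 : fourierCoeff ((g - h : hardySpace p) : Lp ℂ p normLeb) n =
        fourierCoeff (g : Lp ℂ p normLeb) n - fourierCoeff (h : Lp ℂ p normLeb) n :=
      map_sub (coeffL p n) (g : Lp ℂ p normLeb) h
    rcases lt_or_ge n 0 with hn | hn
    · rw [h1, g.2 n hn, h.2 n hn, sub_zero]
    · rw [h1, hg n hn, hh n hn, sub_self]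
  exact sub_eq_zero.1 (Subtype.ext key)

open Classical in
/-- The Riesz projection `P₊ : L^p(𝕋) → H^p`, `∑ f̂(n) e^{inθ} ↦ ∑_{n ≥ 0} f̂(n) e^{inθ}`. For
`1 < p < ∞` every `f ∈ L^p` has exactly one projection in `H^p`, by the theorem of M. Riesz; the
default value `0` is only used for `p = 1` and `p = ∞`. -/
noncomputable def rieszProjection (p : ℝ≥0∞) [Fact (1 ≤ p)] (f : Lp ℂ p normLeb) : hardySpace p :=
  if h : ∃ g : hardySpace p, IsRieszProjection p f g then h.choose else 0

lemma rieszProjection_eq {p : ℝ≥0∞} [Fact (1 ≤ p)] {f : Lp ℂ p normLeb} {g : hardySpace p}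
    (hg : IsRieszProjection p f g) : rieszProjection p f = g := by
  have h : ∃ g : hardySpace p, IsRieszProjection p f g := ⟨g, hg⟩
  rw [rieszProjection, dif_pos h]
  exact h.choose_spec.unique hg

/-- The Toeplitz operator `T_F u = P₊(F u)`, `u ∈ H^p`, with symbol `F ∈ L^∞(𝕋)`. -/
noncomputable def toeplitz (p : ℝ≥0∞) [Fact (1 ≤ p)] (F : Lp ℂ ∞ normLeb) (u : hardySpace p) :
    hardySpace p :=
  rieszProjection p (F • (u : Lp ℂ p normLeb) : Lp ℂ p normLeb)

/-- The symbol `F(e^{iθ}) = a e^{-iθ} + b + c e^{iθ}`. -/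
noncomputable def ellipticSymbol (a b c : ℂ) : C(Torus, ℂ) where
  toFun t := a * fourier (-1) t + b + c * fourier 1 t
  continuous_toFun := by fun_prop

lemma ellipticSymbol_coe (a b c : ℂ) (θ : ℝ) :
    ellipticSymbol a b c (θ : Torus) =
      a * Complex.exp (-(θ * Complex.I)) + b + c * Complex.exp (θ * Complex.I) := by
  have h : (2 * (π : ℂ)) ≠ 0 := by
    simp [Real.pi_ne_zero]
  simp only [ellipticSymbol, ContinuousMap.coe_mk, fourier_coe_apply]
  congr 3
  · congr 1
    congr 1
    push_cast
    field_simp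
  · congr 1
    push_cast
    field_simp

/-- The symbol as an element of `L^∞(𝕋)`. -/
noncomputable def ellipticSymbolLinfty (a b c : ℂ) : Lp ℂ ∞ normLeb :=
  ContinuousMap.toLp ∞ normLeb ℂ (ellipticSymbol a b c)

lemma coeFn_symbol_smul (p : ℝ≥0∞) (a b c : ℂ) (u : Lp ℂ p normLeb) :
    (ellipticSymbolLinfty a b c • u : Lp ℂ p normLeb) =ᵐ[normLeb]
      fun t => ellipticSymbol a b c t * u t := by
  filter_upwards [Lp.coeFn_lpSMul (r := p) (ellipticSymbolLinfty a b c) u,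
    ContinuousMap.coeFn_toLp (p := ∞) (𝕜 := ℂ) normLeb (ellipticSymbol a b c)] with t h1 h2
  rw [h1, Pi.smul_apply', ellipticSymbolLinfty, h2, smul_eq_mul]

lemma fourierCoeff_symbol_smul (p : ℝ≥0∞) [Fact (1 ≤ p)] (a b c : ℂ) (u : Lp ℂ p normLeb)
    (n : ℤ) :
    fourierCoeff (ellipticSymbolLinfty a b c • u : Lp ℂ p normLeb) n =
      a * fourierCoeff u (n + 1) + b * fourierCoeff u n + c * fourierCoeff u (n - 1) := by
  have hu := integrable_of_Lp p u
  rw [fourierCoeff_congr_ae (coeFn_symbol_smul p a b c u)]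
  simp only [fourierCoeff, smul_eq_mul]
  have hi := fun k : ℤ => hu.fourier_smul k
  simp only [smul_eq_mul] at hi
  rw [← integral_const_mul, ← integral_const_mul, ← integral_const_mul,
    ← integral_add ((hi _).const_mul _) ((hi _).const_mul _),
    ← integral_add (by exact ((hi _).const_mul _).add ((hi _).const_mul _)) ((hi _).const_mul _)]
  refine integral_congr_ae (Filter.Eventually.of_forall fun t => ?_)
  have e1 : (fourier (-(n + 1)) t : ℂ) = fourier (-n) t * fourier (-1) t := by
    rw [← fourier_add]; congr 2; ring
  have e2 : (fourier (-(n - 1)) t : ℂ) = fourier (-n) t * fourier 1 t := by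
    rw [← fourier_add]; congr 2; ring
  simp only [e1, e2, ellipticSymbol, ContinuousMap.coe_mk]
  ring

/-- The Fourier coefficients of the monomial `e^{imθ}`. -/
lemma fourierCoeff_fourierLp (p : ℝ≥0∞) [Fact (1 ≤ p)] (m n : ℤ) :
    fourierCoeff (fourierLp p m : Lp ℂ p normLeb) n = if n = m then 1 else 0 := by
  have h2 := (orthonormal_iff_ite.1 (@orthonormal_fourier (2 * π) _)) n m
  rw [ContinuousMap.inner_toLp] at h2
  rw [fourierCoeff_congr_ae (coeFn_fourierLp p m), ← h2, fourierCoeff]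
  refine integral_congr_ae (Filter.Eventually.of_forall fun t => ?_)
  simp only [smul_eq_mul, fourier_neg]
  ring

/-- The function `F u - a û(0) e^{-iθ}`, an element of `H^p`. -/
noncomputable def ellipticImage (p : ℝ≥0∞) [Fact (1 ≤ p)] (a b c : ℂ) (u : hardySpace p) :
    hardySpace p :=
  ⟨(ellipticSymbolLinfty a b c • (u : Lp ℂ p normLeb) : Lp ℂ p normLeb) -
      (a * fourierCoeff (u : Lp ℂ p normLeb) 0) • fourierLp p (-1), fun n hn => by
    rw [← coeffL_apply p, map_sub, map_smul, coeffL_apply, coeffL_apply,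
      fourierCoeff_symbol_smul, fourierCoeff_fourierLp, u.2 n hn, u.2 (n - 1) (by omega)]
    by_cases h : n = -1
    · subst h; simp
    · rw [u.2 (n + 1) (by omega)]; simp [h]⟩

lemma isRieszProjection_ellipticImage (p : ℝ≥0∞) [Fact (1 ≤ p)] (a b c : ℂ) (u : hardySpace p) :
    IsRieszProjection p (ellipticSymbolLinfty a b c • (u : Lp ℂ p normLeb) : Lp ℂ p normLeb)
      (ellipticImage p a b c u) := by
  intro n hn
  rw [ellipticImage, ← coeffL_apply p, map_sub, map_smul, coeffL_apply, coeffL_apply,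
    fourierCoeff_fourierLp, if_neg (by omega)]
  simp

lemma toeplitz_elliptic (p : ℝ≥0∞) [Fact (1 ≤ p)] (a b c : ℂ) (u : hardySpace p) :
    toeplitz p (ellipticSymbolLinfty a b c) u = ellipticImage p a b c u :=
  rieszProjection_eq (isRieszProjection_ellipticImage p a b c u)

/-- For `F(e^{iθ}) = a e^{-iθ} + b + c e^{iθ}` the projection in `T_F u` is explicit:
`T_F u = F u - a û(0) e^{-iθ}`. -/
lemma coe_toeplitz_elliptic (p : ℝ≥0∞) [Fact (1 ≤ p)] (a b c : ℂ) (u : hardySpace p) :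
    (toeplitz p (ellipticSymbolLinfty a b c) u : Lp ℂ p normLeb) =
      (ellipticSymbolLinfty a b c • (u : Lp ℂ p normLeb) : Lp ℂ p normLeb) -
        (a * fourierCoeff (u : Lp ℂ p normLeb) 0) • fourierLp p (-1) := by
  rw [toeplitz_elliptic]
  rfl

/-- The function `T_F u` is indeed the Riesz projection of `F u`. -/
lemma isRieszProjection_toeplitz_elliptic (p : ℝ≥0∞) [Fact (1 ≤ p)] (a b c : ℂ)
    (u : hardySpace p) :
    IsRieszProjection p (ellipticSymbolLinfty a b c • (u : Lp ℂ p normLeb) : Lp ℂ p normLeb)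
      (toeplitz p (ellipticSymbolLinfty a b c) u) := by
  rw [toeplitz_elliptic]
  exact isRieszProjection_ellipticImage p a b c u

/-- The Toeplitz operator `T_F` with `F(e^{iθ}) = a e^{-iθ} + b + c e^{iθ}`, as a bounded operator
on `H^p`. -/
noncomputable def toeplitzElliptic (p : ℝ≥0∞) [Fact (1 ≤ p)] (a b c : ℂ) :
    hardySpace p →L[ℂ] hardySpace p where
  toFun := toeplitz p (ellipticSymbolLinfty a b c)
  map_add' u v := by
    refine rieszProjection_eq fun n hn => ?_
    have hu := isRieszProjection_toeplitz_elliptic p a b c u n hn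
    have hv := isRieszProjection_toeplitz_elliptic p a b c v n hn
    rw [Submodule.coe_add, Submodule.coe_add, Lp.add_smul, fourierCoeff_Lp_add, hu, hv,
      fourierCoeff_Lp_add]
  map_smul' k u := by
    refine rieszProjection_eq fun n hn => ?_
    have hu := isRieszProjection_toeplitz_elliptic p a b c u n hn
    simp only [RingHom.id_apply, Submodule.coe_smul]
    rw [fourierCoeff_Lp_smul, hu]
    simp only [fourierCoeff_symbol_smul, fourierCoeff_Lp_smul]
    ring
  cont := by
    rw [continuous_induced_rng]
    have h1 : Continuous fun u : Lp ℂ p normLeb =>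
        (ellipticSymbolLinfty a b c • u : Lp ℂ p normLeb) := by
      refine (AddMonoidHomClass.lipschitz_of_bound
        (AddMonoidHom.mk' (fun u : Lp ℂ p normLeb =>
          (ellipticSymbolLinfty a b c • u : Lp ℂ p normLeb)) fun u v => Lp.add_smul _ u v)
        ‖ellipticSymbolLinfty a b c‖ fun u => Lp.norm_smul_le _ u).continuous
    have h2 : Continuous fun u : Lp ℂ p normLeb => fourierCoeff u 0 := (coeffL p 0).continuous
    have h3 : Continuous fun u : Lp ℂ p normLeb =>
        (ellipticSymbolLinfty a b c • u : Lp ℂ p normLeb) -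
          (a * fourierCoeff u 0) • fourierLp p (-1) :=
      h1.sub ((continuous_const.mul h2).smul continuous_const)
    refine (h3.comp continuous_subtype_val).congr fun u => ?_
    exact (coe_toeplitz_elliptic p a b c u).symm

/-- A bounded operator is hypercyclic if some vector has a dense orbit `{Tⁿ x ; n ≥ 0}`. -/
def IsHypercyclic {X : Type*} [NormedAddCommGroup X] [NormedSpace ℂ X] (T : X →L[ℂ] X) : Prop :=
  ∃ x : X, Dense (Set.range fun n : ℕ => (T ^ n) x)

/-- The interior of a closed curve with trace `K ⊆ ℂ`, i.e. the union of the bounded connected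
components of `ℂ \ K`; for a Jordan curve there is exactly one such component. -/
def curveInterior (K : Set ℂ) : Set ℂ :=
  {z | z ∈ Kᶜ ∧ Bornology.IsBounded (connectedComponentIn Kᶜ z)}

end HardyToeplitz

/-!
The operator `T = T_F` with `F = a z⁻¹ + b + c z` is studied through its eigenvectors and through
Fourier coefficients of `G u` for weights `G` adapted to `F`.

*The ellipse.* For `|c| < |a|` the real-linear form `ā w - c w̄` inverts `α ↦ a α + c ᾱ` up to the
factor `|a|² - |c|²`. Hence the curve and its interior are given by
`|ā w - c w̄| = |a|² - |c|²` and `|ā w - c w̄| < |a|² - |c|²` with `w = λ - b`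
(`range_ellipticSymbol`, `curveInterior_ellipticSymbol`). The interior is convex, and there both
solutions `x` of `a x + c / x = w` lie in the open unit disc, whereas outside the curve one of them
lies outside the closed disc (`roots_norm_lt_one`, `exists_root_one_lt_norm`).

*Sufficiency.* With `v(x) = ∑ xⁿ⁺¹ zⁿ`, the vector `v(x) - v(y)` is an eigenvector of `T` for
`b + a (x + y)` if `a x y = c`. Eigenvectors with eigenvalue in a nonempty open subset of the
interior span a dense subspace (`dense_span_eigenvectors`): for an annihilating functional `φ` the
power series `f(x) = φ(v(x))` satisfies `f(x) = f(r / x)`, `r = c / a`, near a point of the annulus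
`|r| < |x| < 1`, hence on all of it, and comparison of the Laurent coefficients gives
`φ(zⁿ) = 0` for all `n`. Then `φ = 0`, since for an extension `ψ` of `φ` to `Lᵖ` the continuous
function `t ↦ ψ(u(· + t))` has vanishing Fourier coefficients. If the interior meets the unit
circle, it meets both sides of the circle, and the Godefroy–Shapiro criterion applies
(`isHypercyclic_of_eigenvectors`).

*Necessity.* If `|a| < |c|`, the adjoint of `T` has an eigenvector
(`not_isHypercyclic_of_norm_lt`). Let `|c| < |a|` and suppose that the interior misses the unit
circle. By convexity either `|F| ≤ 1` on the circle, or `|F| ≥ 1` there and the origin lies outside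
the curve (`ellipse_dichotomy`). The functional `ψ(f) = f̂(0) - r f̂(-2)` satisfies
`ψ(G · T u) = ψ(G F u)` for every weight `G` with the symmetry `Ĝ(k) = rᵏ Ĝ(-k)`, `k ≥ 0`, and
`ψ(u) = û(0)` on the Hardy space. The powers of `F` are symmetric, so in the first case
`|(Tⁿ u)^(0)| = |ψ(Fⁿ u)| ≤ 2 ‖u‖`. In the second case the negative powers are symmetric as well,
because the symmetry defect is a bounded solution of a three-term recurrence with an exterior root;
so `|û(0)| = |ψ(F⁻ⁿ Tⁿ u)| ≤ 2 ‖Tⁿ u‖`. Both estimates exclude dense orbits, and neither uses the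
boundedness of the Riesz projection.
-/

open Filter Topology

namespace HardyToeplitz

/-! ### Criteria for hypercyclicity -/

section Dynamics

variable {X : Type*} [NormedAddCommGroup X] [NormedSpace ℂ X]

/-- **Birkhoff's transitivity theorem**: on a separable Banach space a topologically transitive
operator is hypercyclic. By Baire's theorem the vectors whose orbit meets every member of a
countable basis are dense. -/
theorem isHypercyclic_of_transitive [CompleteSpace X] [SecondCountableTopology X] (T : X →L[ℂ] X)
    (h : ∀ U V : Set X, IsOpen U → IsOpen V → U.Nonempty → V.Nonempty →
      ∃ n : ℕ, ∃ x ∈ U, (T ^ n) x ∈ V) : IsHypercyclic T := by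
  let B := TopologicalSpace.countableBasis X
  have hB := TopologicalSpace.isBasis_countableBasis X
  have : Countable B := TopologicalSpace.countable_countableBasis X
  have hd : Dense (⋂ V : B, ⋃ n : ℕ, (T ^ n) ⁻¹' (V : Set X)) := by
    refine dense_iInter_of_isOpen (fun V => isOpen_iUnion fun n =>
      (hB.isOpen V.2).preimage (T ^ n).continuous) fun V => ?_
    rw [dense_iff_inter_open]
    intro U hU hUne
    obtain ⟨n, x, hxU, hxV⟩ := h U V hU (hB.isOpen V.2) hUne
      (TopologicalSpace.nonempty_of_mem_countableBasis V.2)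
    exact ⟨x, hxU, Set.mem_iUnion.2 ⟨n, hxV⟩⟩
  obtain ⟨x, hx⟩ := hd.nonempty
  refine ⟨x, hB.dense_iff.2 fun V hV _ => ?_⟩
  obtain ⟨n, hn⟩ := Set.mem_iUnion.1 (Set.mem_iInter.1 hx ⟨V, hV⟩)
  exact ⟨_, hn, n, rfl⟩

lemma pow_apply_of_eigen {T : X →L[ℂ] X} {x : X} {l : ℂ} (h : T x = l • x) (n : ℕ) :
    (T ^ n) x = l ^ n • x := by
  induction n with
  | zero => simp
  | succ n ih => rw [pow_succ', mul_apply_eq_comp, ih, map_smul, h, smul_smul, pow_succ]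

/-- **Godefroy–Shapiro criterion**: an operator is hypercyclic if the eigenvectors with eigenvalue
in the open unit disc and those with eigenvalue outside the closed unit disc both span dense
subspaces. -/
theorem isHypercyclic_of_eigenvectors [CompleteSpace X] [SecondCountableTopology X]
    (T : X →L[ℂ] X) {S₁ S₂ : Set X} (h₁ : ∀ x ∈ S₁, ∃ l : ℂ, ‖l‖ < 1 ∧ T x = l • x)
    (h₂ : ∀ x ∈ S₂, ∃ l : ℂ, 1 < ‖l‖ ∧ T x = l • x)
    (hd₁ : Dense (Submodule.span ℂ S₁ : Set X)) (hd₂ : Dense (Submodule.span ℂ S₂ : Set X)) :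
    IsHypercyclic T := by
  have k₁ : ∀ x ∈ Submodule.span ℂ S₁, Tendsto (fun n : ℕ => (T ^ n) x) atTop (𝓝 0) := by
    intro x hx
    induction hx using Submodule.span_induction with
    | mem x hx =>
      obtain ⟨l, hl, hx⟩ := h₁ x hx
      simp only [pow_apply_of_eigen hx]
      simpa using (tendsto_pow_atTop_nhds_zero_of_norm_lt_one hl).smul_const x
    | zero => simp
    | add x y _ _ hx hy => simpa using hx.add hy
    | smul k x _ hx => simpa using hx.const_smul k
  have k₂ : ∀ y ∈ Submodule.span ℂ S₂, ∃ s : ℕ → X, Tendsto s atTop (𝓝 0) ∧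
      ∀ n, (T ^ n) (s n) = y := by
    intro y hy
    induction hy using Submodule.span_induction with
    | mem x hx =>
      obtain ⟨l, hl, hx⟩ := h₂ x hx
      have hl0 : l ≠ 0 := norm_pos_iff.1 (zero_lt_one.trans hl)
      refine ⟨fun n => l⁻¹ ^ n • x, ?_, fun n => ?_⟩
      · have : ‖l⁻¹‖ < 1 := by rw [norm_inv]; exact inv_lt_one_of_one_lt₀ hl
        simpa using (tendsto_pow_atTop_nhds_zero_of_norm_lt_one this).smul_const x
      · rw [map_smul, pow_apply_of_eigen hx, smul_smul, ← mul_pow, inv_mul_cancel₀ hl0, one_pow,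
          one_smul]
    | zero => exact ⟨0, tendsto_const_nhds, by simp⟩
    | add x y _ _ hx hy =>
      obtain ⟨s, hs, hs'⟩ := hx
      obtain ⟨t, ht, ht'⟩ := hy
      exact ⟨fun n => s n + t n, by simpa using hs.add ht, fun n => by rw [map_add, hs', ht']⟩
    | smul k x _ hx =>
      obtain ⟨s, hs, hs'⟩ := hx
      exact ⟨fun n => k • s n, by simpa using hs.const_smul k, fun n => by rw [map_smul, hs']⟩
  refine isHypercyclic_of_transitive T fun U V hU hV hUne hVne => ?_
  obtain ⟨x, hxU, hx⟩ := hd₁.inter_open_nonempty U hU hUne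
  obtain ⟨y, hyV, hy⟩ := hd₂.inter_open_nonempty V hV hVne
  obtain ⟨s, hs, hs'⟩ := k₂ y hy
  have e₁ : Tendsto (fun n => x + s n) atTop (𝓝 x) := by simpa using hs.const_add x
  have e₂ : Tendsto (fun n => (T ^ n) (x + s n)) atTop (𝓝 y) := by
    have := (k₁ x hx).add_const y
    rw [zero_add] at this
    simpa only [map_add, hs'] using this
  obtain ⟨n, hn₁, hn₂⟩ :=
    ((e₁.eventually (hU.mem_nhds hxU)).and (e₂.eventually (hV.mem_nhds hyV))).exists
  exact ⟨n, _, hn₁, hn₂⟩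

/-- The image of a dense orbit under a nonzero functional is dense in the plane. -/
lemma denseRange_functional_orbit {T : X →L[ℂ] X} {x : X}
    (hx : Dense (Set.range fun n : ℕ => (T ^ n) x)) {φ : X →L[ℂ] ℂ} (hφ : φ ≠ 0) :
    DenseRange fun n : ℕ => φ ((T ^ n) x) := by
  have hs : Function.Surjective φ :=
    LinearMap.surjective (f := (φ : X →ₗ[ℂ] ℂ)) fun h => hφ (ContinuousLinearMap.coe_injective h)
  have hd : DenseRange fun n : ℕ => (T ^ n) x := hx
  exact hs.denseRange.comp hd φ.continuous

lemma not_dense_of_norm_le {f : ℕ → ℂ} (C : ℝ) (h : ∀ n, ‖f n‖ ≤ C) : ¬ DenseRange f := by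
  intro hf
  have hcl : closure (Set.range f) ⊆ Metric.closedBall 0 C :=
    closure_minimal (by rintro _ ⟨n, rfl⟩; simpa using h n) Metric.isClosed_closedBall
  rw [hf.closure_range] at hcl
  have := hcl (Set.mem_univ ((|C| + 1 : ℝ) : ℂ))
  rw [mem_closedBall_zero_iff, Complex.norm_real, Real.norm_eq_abs,
    abs_of_pos (by positivity)] at this
  linarith [le_abs_self C]

/-- The adjoint of a hypercyclic operator has no eigenvalue. -/
theorem not_isHypercyclic_of_adjoint_eigenvector (T : X →L[ℂ] X) {φ : X →L[ℂ] ℂ} (hφ : φ ≠ 0)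
    {l : ℂ} (h : ∀ u, φ (T u) = l * φ u) : ¬ IsHypercyclic T := by
  rintro ⟨x, hx⟩
  have hd := denseRange_functional_orbit hx hφ
  have e : ∀ n : ℕ, φ ((T ^ n) x) = l ^ n * φ x := by
    intro n
    induction n with
    | zero => simp
    | succ n ih => rw [pow_succ', mul_apply_eq_comp, h, ih, pow_succ]; ring
  by_cases hl : ‖l‖ ≤ 1 ∨ φ x = 0
  · refine not_dense_of_norm_le ‖φ x‖ (fun n => ?_) hd
    rw [e, norm_mul, norm_pow]
    rcases hl with hl | hl
    · exact mul_le_of_le_one_left (norm_nonneg _) (pow_le_one₀ (norm_nonneg _) hl)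
    · simp [hl]
  · push Not at hl
    obtain ⟨z, hz, n, rfl⟩ := hd.inter_open_nonempty (Metric.ball 0 ‖φ x‖) Metric.isOpen_ball
      ⟨0, by simpa using hl.2⟩
    rw [mem_ball_zero_iff] at hz
    beta_reduce at hz
    rw [e, norm_mul, norm_pow] at hz
    exact absurd hz (not_lt.2 (le_mul_of_one_le_left (norm_nonneg _) (one_le_pow₀ hl.1.le)))

/-- If some nonzero functional is bounded along every orbit, there is no dense orbit. -/
theorem not_isHypercyclic_of_bounded_functional (T : X →L[ℂ] X) {φ : X →L[ℂ] ℂ} (hφ : φ ≠ 0)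
    {C : ℝ} (h : ∀ u, ∀ n : ℕ, ‖φ ((T ^ n) u)‖ ≤ C * ‖u‖) : ¬ IsHypercyclic T := by
  rintro ⟨x, hx⟩
  exact not_dense_of_norm_le (C * ‖x‖) (h x) (denseRange_functional_orbit hx hφ)

/-- If `‖Tⁿ u‖` is bounded below by a nonzero functional of `u`, uniformly in `n`, there is no dense
orbit: from the moment the functional is nonzero, the orbit stays away from the origin. -/
theorem not_isHypercyclic_of_functional_le (T : X →L[ℂ] X) {φ : X →L[ℂ] ℂ} (hφ : φ ≠ 0)
    {C : ℝ} (h : ∀ u, ∀ n : ℕ, ‖φ u‖ ≤ C * ‖(T ^ n) u‖) : ¬ IsHypercyclic T := by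
  rintro ⟨x, hx⟩
  obtain ⟨z, hz, k, rfl⟩ := (denseRange_functional_orbit hx hφ).inter_open_nonempty {0}ᶜ
    isOpen_compl_singleton ⟨1, by simp⟩
  have hz : φ ((T ^ k) x) ≠ 0 := hz
  have : Nontrivial X := by
    by_contra hX
    rw [not_nontrivial_iff_subsingleton] at hX
    exact hφ (ContinuousLinearMap.ext fun u => by rw [Subsingleton.elim u 0]; simp)
  have : ∀ y : X, (𝓝[≠] y).NeBot := fun y => Module.punctured_nhds_neBot ℂ X y
  have hd := hx.sdiff_finite ((Set.finite_lt_nat k).image fun n => (T ^ n) x)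
  have hopen : IsOpen {y : X | C * ‖y‖ < ‖φ ((T ^ k) x)‖} :=
    isOpen_lt (by fun_prop) continuous_const
  obtain ⟨y, hy, ⟨m, rfl⟩, hm⟩ := hd.inter_open_nonempty _ hopen ⟨0, by simpa using hz⟩
  have hkm : k ≤ m := by
    by_contra hlt
    exact hm ⟨m, not_le.1 hlt, rfl⟩
  obtain ⟨j, rfl⟩ := Nat.exists_eq_add_of_le' hkm
  have := h ((T ^ k) x) j
  rw [← mul_apply_eq_comp, ← pow_add] at this
  exact absurd hy (not_lt.2 this)

/-- A subspace annihilated by no nonzero functional is dense. -/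
lemma dense_span_of_annihilator {S : Set X}
    (h : ∀ φ : X →L[ℂ] ℂ, (∀ x ∈ S, φ x = 0) → φ = 0) :
    Dense (Submodule.span ℂ S : Set X) := by
  rw [Submodule.dense_iff_topologicalClosure_eq_top]
  by_contra hne
  let W := (Submodule.span ℂ S).topologicalClosure
  have : IsClosed (W : Set X) := Submodule.isClosed_topologicalClosure _
  obtain ⟨x, hx⟩ : ∃ x, x ∉ W := by
    by_contra! hall
    exact hne (Submodule.eq_top_iff'.2 hall)
  obtain ⟨f, hf⟩ := SeparatingDual.exists_ne_zero (R := ℂ)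
    (mt (Submodule.Quotient.mk_eq_zero W).1 hx)
  let φ : X →L[ℂ] ℂ := f.comp W.mkQL
  have hφ : φ = 0 := h φ fun y hy => by
    have : W.mkQL y = 0 := (Submodule.Quotient.mk_eq_zero W).2
      (Submodule.le_topologicalClosure _ (Submodule.subset_span hy))
    simp [φ, this]
  exact hf (congrArg (fun g : X →L[ℂ] ℂ => g x) hφ)

end Dynamics

/-! ### The ellipse -/

open ComplexConjugate

/-- The real-linear form `w ↦ ā w - c w̄`. It inverts `α ↦ a α + c ᾱ` up to the factor
`|a|² - |c|²`, so that its norm is, for `|c| < |a|`, a multiple of the gauge of the ellipse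
`{a α + c ᾱ : |α| = 1}`. -/
noncomputable def ellipseForm (a c : ℂ) : ℂ →L[ℝ] ℂ :=
  conj a • ContinuousLinearMap.id ℝ ℂ - c • (Complex.conjCLE : ℂ →L[ℝ] ℂ)

lemma ellipseForm_apply (a c w : ℂ) : ellipseForm a c w = conj a * w - c * conj w := by
  simp [ellipseForm]

lemma ellipseForm_add_conj (a c x : ℂ) :
    ellipseForm a c (a * x + c * conj x) = ((‖a‖ ^ 2 - ‖c‖ ^ 2 : ℝ) : ℂ) * x := by
  rw [ellipseForm_apply]
  push_cast
  rw [← Complex.mul_conj', ← Complex.mul_conj']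
  simp only [map_add, map_mul, Complex.conj_conj]
  ring

lemma add_conj_ellipseForm (a c w : ℂ) :
    a * ellipseForm a c w + c * conj (ellipseForm a c w) = ((‖a‖ ^ 2 - ‖c‖ ^ 2 : ℝ) : ℂ) * w := by
  rw [ellipseForm_apply]
  push_cast
  rw [← Complex.mul_conj', ← Complex.mul_conj']
  simp only [map_sub, map_mul, Complex.conj_conj]
  ring

/-- The form along `x ↦ a x + c / x`, after substituting `1 / x = x̄ / |x|²`. -/
lemma ellipseForm_joukowski (a c : ℂ) {x : ℂ} (hx : x ≠ 0) :
    ellipseForm a c (a * x + c / x) = ((‖a‖ ^ 2 - ‖c‖ ^ 2 / ‖x‖ ^ 2 : ℝ) : ℂ) * x +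
      conj a * c * ((1 / ‖x‖ ^ 2 - 1 : ℝ) : ℂ) * conj x := by
  have hx' : conj x ≠ 0 := (map_ne_zero _).2 hx
  rw [ellipseForm_apply]
  push_cast
  rw [← Complex.mul_conj' a, ← Complex.mul_conj' c, ← Complex.mul_conj' x]
  simp only [map_add, map_mul, map_div₀]
  field_simp
  ring

lemma sq_norm_sub_pos {a c : ℂ} (hac : ‖c‖ < ‖a‖) : 0 < ‖a‖ ^ 2 - ‖c‖ ^ 2 := by
  nlinarith [norm_nonneg a, norm_nonneg c]

/-- The triangle inequality bounds the form below by `(|a| - |c|) (|a| |x| + |c| / |x|)`, which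
exceeds `|a|² - |c|²` by `(|a| - |c|) (|x| - 1) (|a| - |c| / |x|)`. -/
lemma le_norm_ellipseForm {a c : ℂ} (hac : ‖c‖ < ‖a‖) {x : ℂ} (hx : 1 ≤ ‖x‖) :
    ‖a‖ ^ 2 - ‖c‖ ^ 2 ≤ ‖ellipseForm a c (a * x + c / x)‖ := by
  have hx0 : 0 < ‖x‖ := by linarith
  rw [ellipseForm_joukowski a c (norm_pos_iff.1 hx0)]
  have h1 : (1 / ‖x‖ ^ 2 - 1 : ℝ) ≤ 0 := by
    rw [sub_nonpos, div_le_one (by positivity)]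
    exact one_le_pow₀ hx
  refine le_trans ?_ (norm_sub_le_norm_add _ _)
  rw [norm_mul, norm_mul, norm_mul, norm_mul, Complex.norm_real, Complex.norm_real,
    RCLike.norm_conj, RCLike.norm_conj, Real.norm_of_nonpos h1]
  refine le_trans ?_ (sub_le_sub_right (mul_le_mul_of_nonneg_right (le_abs_self _) hx0.le) _)
  have key : (‖a‖ ^ 2 - ‖c‖ ^ 2 / ‖x‖ ^ 2) * ‖x‖ - ‖a‖ * ‖c‖ * -(1 / ‖x‖ ^ 2 - 1) * ‖x‖ -
      (‖a‖ ^ 2 - ‖c‖ ^ 2) = (‖a‖ - ‖c‖) * (‖x‖ - 1) * (‖a‖ * ‖x‖ - ‖c‖) / ‖x‖ := by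
    field_simp
    ring
  have : 0 ≤ (‖a‖ - ‖c‖) * (‖x‖ - 1) * (‖a‖ * ‖x‖ - ‖c‖) / ‖x‖ := by
    refine div_nonneg (mul_nonneg (mul_nonneg (by linarith) (by linarith)) ?_) hx0.le
    nlinarith [norm_nonneg a]
  linarith

/-- For `|c| / |a| ≤ |x| ≤ 1` the bound of `le_norm_ellipseForm` is reversed: the form is at most
`|a|² - |c|²`. -/
lemma norm_ellipseForm_le {a c : ℂ} (hac : ‖c‖ < ‖a‖) {x : ℂ} (hx0 : x ≠ 0) (hx : ‖x‖ ≤ 1)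
    (hcx : ‖c‖ ≤ ‖a‖ * ‖x‖) :
    ‖ellipseForm a c (a * x + c / x)‖ ≤ ‖a‖ ^ 2 - ‖c‖ ^ 2 := by
  rw [ellipseForm_joukowski a c hx0]
  rw [← norm_pos_iff] at hx0
  have h1 : 0 ≤ (1 / ‖x‖ ^ 2 - 1 : ℝ) := by
    rw [sub_nonneg, le_div_iff₀ (by positivity), one_mul]
    exact pow_le_one₀ hx0.le hx
  have h2 : 0 ≤ ‖a‖ ^ 2 - ‖c‖ ^ 2 / ‖x‖ ^ 2 := by
    rw [sub_nonneg, div_le_iff₀ (by positivity), ← mul_pow]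
    exact pow_le_pow_left₀ (norm_nonneg _) hcx 2
  refine (norm_add_le _ _).trans ?_
  rw [norm_mul, norm_mul, norm_mul, norm_mul, Complex.norm_real, Complex.norm_real,
    RCLike.norm_conj, RCLike.norm_conj, Real.norm_of_nonneg h1, Real.norm_of_nonneg h2]
  have key : (‖a‖ ^ 2 - ‖c‖ ^ 2 / ‖x‖ ^ 2) * ‖x‖ + ‖a‖ * ‖c‖ * (1 / ‖x‖ ^ 2 - 1) * ‖x‖ -
      (‖a‖ ^ 2 - ‖c‖ ^ 2) = - ((‖a‖ - ‖c‖) * (1 - ‖x‖) * (‖a‖ * ‖x‖ - ‖c‖) / ‖x‖) := by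
    field_simp
    ring
  have : 0 ≤ (‖a‖ - ‖c‖) * (1 - ‖x‖) * (‖a‖ * ‖x‖ - ‖c‖) / ‖x‖ :=
    div_nonneg (mul_nonneg (mul_nonneg (by linarith) (by linarith)) (by linarith)) hx0.le
  linarith

lemma exists_roots {a : ℂ} (ha : a ≠ 0) (w c : ℂ) :
    ∃ x y : ℂ, a * (x + y) = w ∧ a * (x * y) = c := by
  obtain ⟨s, hs⟩ := IsAlgClosed.exists_pow_nat_eq (w ^ 2 - 4 * a * c) (n := 2) (by norm_num)
  refine ⟨(w + s) / (2 * a), (w - s) / (2 * a), ?_, ?_⟩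
  · field_simp
    ring
  · field_simp
    linear_combination - hs

/-- Inside the ellipse both solutions `x` of `a x + c / x = w` lie in the open unit disc. -/
lemma roots_norm_lt_one {a c : ℂ} (hac : ‖c‖ < ‖a‖) {x y w : ℂ} (hw : a * (x + y) = w)
    (hc : a * (x * y) = c) (h : ‖ellipseForm a c w‖ < ‖a‖ ^ 2 - ‖c‖ ^ 2) :
    ‖x‖ < 1 ∧ ‖y‖ < 1 := by
  have key : ∀ x y : ℂ, a * (x + y) = w → a * (x * y) = c → ‖x‖ < 1 := by
    intro x y hw hc
    by_contra! hx
    have hx0 : x ≠ 0 := by rintro rfl; simp at hx; linarith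
    have : w = a * x + c / x := by rw [← hw, ← hc]; field_simp
    rw [this] at h
    exact absurd h (not_lt.2 (le_norm_ellipseForm hac hx))
  exact ⟨key x y hw hc, key y x (by rw [← hw]; ring) (by rw [← hc]; ring)⟩

/-- Outside the ellipse one of the two solutions `x` of `a x + c / x = w` lies outside the closed
unit disc. -/
lemma exists_root_one_lt_norm {a c : ℂ} (hac : ‖c‖ < ‖a‖) {w : ℂ}
    (h : ‖a‖ ^ 2 - ‖c‖ ^ 2 < ‖ellipseForm a c w‖) :
    ∃ x y : ℂ, a * (x + y) = w ∧ a * (x * y) = c ∧ 1 < ‖x‖ := by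
  have ha : a ≠ 0 := norm_pos_iff.1 ((norm_nonneg c).trans_lt hac)
  obtain ⟨x, y, hw, hc⟩ := exists_roots ha w c
  by_contra! hno
  have hx : ‖x‖ ≤ 1 := hno x y hw hc
  have hy : ‖y‖ ≤ 1 := hno y x (by rw [← hw]; ring) (by rw [← hc]; ring)
  have key : ∀ x y : ℂ, a * (x + y) = w → a * (x * y) = c → ‖x‖ ≤ 1 → ‖y‖ ≤ 1 → x = 0 := by
    intro x y hw hc hx hy
    by_contra hx0
    have e : w = a * x + c / x := by rw [← hw, ← hc]; field_simp
    rw [e] at h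
    refine absurd h (not_lt.2 (norm_ellipseForm_le hac hx0 hx ?_))
    rw [← hc, norm_mul, norm_mul]
    exact mul_le_mul_of_nonneg_left (mul_le_of_le_one_right (norm_nonneg _) hy) (norm_nonneg _)
  have hx0 := key x y hw hc hx hy
  have hy0 := key y x (by rw [← hw]; ring) (by rw [← hc]; ring) hy hx
  have hw0 : w = 0 := by rw [← hw, hx0, hy0]; simp
  rw [hw0, map_zero, norm_zero] at h
  linarith [sq_norm_sub_pos hac]

lemma ellipticSymbol_apply (a b c : ℂ) (t : Torus) :
    ellipticSymbol a b c t = a * conj (fourier 1 t : ℂ) + b + c * fourier 1 t := by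
  rw [← fourier_neg]
  rfl

/-- The curve `F(𝕋)` in terms of the form `ā w - c w̄`. -/
lemma range_ellipticSymbol {a c : ℂ} (hac : ‖c‖ < ‖a‖) (b : ℂ) :
    Set.range (ellipticSymbol a b c) = {l | ‖ellipseForm a c (l - b)‖ = ‖a‖ ^ 2 - ‖c‖ ^ 2} := by
  have hpos := sq_norm_sub_pos hac
  have hC : ((‖a‖ ^ 2 - ‖c‖ ^ 2 : ℝ) : ℂ) ≠ 0 := by exact_mod_cast hpos.ne'
  ext l
  constructor
  · rintro ⟨t, rfl⟩
    have e : ellipticSymbol a b c t - b =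
        a * conj (fourier 1 t : ℂ) + c * conj (conj (fourier 1 t : ℂ)) := by
      rw [ellipticSymbol_apply, Complex.conj_conj]; ring
    rw [Set.mem_ofPred_eq, e, ellipseForm_add_conj, norm_mul, Complex.norm_real, RCLike.norm_conj,
      Real.norm_of_nonneg hpos.le, fourier_apply, Circle.norm_coe, mul_one]
  · intro hl
    rw [Set.mem_ofPred_eq] at hl
    set x : ℂ := ellipseForm a c (l - b) / ((‖a‖ ^ 2 - ‖c‖ ^ 2 : ℝ) : ℂ) with hx
    have hx1 : ‖x‖ = 1 := by
      rw [hx, norm_div, hl, Complex.norm_real, Real.norm_of_nonneg hpos.le, div_self hpos.ne']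
    have hl' : l - b = a * x + c * conj x := by
      refine mul_left_cancel₀ hC ?_
      rw [← add_conj_ellipseForm, hx, map_div₀, Complex.conj_ofReal]
      field_simp
    obtain ⟨t, ht⟩ := (AddCircle.homeomorphCircle Real.two_pi_pos.ne').surjective
      ⟨conj x, mem_sphere_zero_iff_norm.2 (by rw [RCLike.norm_conj, hx1])⟩
    have ht' : (fourier 1 t : ℂ) = conj x := by
      rw [fourier_one, ← AddCircle.homeomorphCircle_apply Real.two_pi_pos.ne', ht]
    refine ⟨t, ?_⟩
    rw [ellipticSymbol_apply, ht', Complex.conj_conj]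
    linear_combination - hl'

lemma continuous_norm_ellipseForm (a b c : ℂ) :
    Continuous fun l : ℂ => ‖ellipseForm a c (l - b)‖ := by fun_prop

/-- The interior of the ellipse `F(𝕋)`. -/
lemma curveInterior_ellipticSymbol {a c : ℂ} (hac : ‖c‖ < ‖a‖) (b : ℂ) :
    curveInterior (Set.range (ellipticSymbol a b c)) =
      {l | ‖ellipseForm a c (l - b)‖ < ‖a‖ ^ 2 - ‖c‖ ^ 2} := by
  have hpos := sq_norm_sub_pos hac
  rw [range_ellipticSymbol hac]
  set K := {l | ‖ellipseForm a c (l - b)‖ = ‖a‖ ^ 2 - ‖c‖ ^ 2}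
  ext l
  constructor
  · rintro ⟨hlK, hbd⟩
    by_contra hl
    have hl : ‖a‖ ^ 2 - ‖c‖ ^ 2 < ‖ellipseForm a c (l - b)‖ :=
      lt_of_le_of_ne (not_lt.1 hl) (Ne.symm hlK)
    have hlb : 0 < ‖l - b‖ := by
      rw [norm_pos_iff]
      intro h0
      rw [h0, map_zero, norm_zero] at hl
      linarith
    -- The ray from the centre through an outer point never returns to the curve.
    have hray : (fun t : ℝ => b + t • (l - b)) '' Set.Ici 1 ⊆ connectedComponentIn Kᶜ l := by
      refine IsPreconnected.subset_connectedComponentIn ?_ ⟨1, Set.self_mem_Ici, by simp⟩ ?_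
      · exact isPreconnected_Ici.image _ (by fun_prop)
      · rintro _ ⟨t, ht, rfl⟩
        rw [Set.mem_Ici] at ht
        have : ‖ellipseForm a c (b + t • (l - b) - b)‖ = t * ‖ellipseForm a c (l - b)‖ := by
          rw [add_sub_cancel_left, map_smul, norm_smul, Real.norm_of_nonneg (by linarith)]
        refine ne_of_gt ?_
        rw [this]
        nlinarith
    obtain ⟨R, hR⟩ := (hbd.subset hray).exists_norm_le
    have h1 : (1 : ℝ) ≤ 1 + (|R| + ‖b‖ + 1) / ‖l - b‖ := by
      have : 0 ≤ (|R| + ‖b‖ + 1) / ‖l - b‖ := by positivity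
      linarith
    have h2 := hR _ ⟨_, h1, rfl⟩
    have h3 := norm_sub_le_norm_add ((1 + (|R| + ‖b‖ + 1) / ‖l - b‖) • (l - b)) b
    rw [add_comm _ b, norm_smul, Real.norm_of_nonneg (by linarith), add_mul, one_mul,
      div_mul_cancel₀ _ hlb.ne'] at h3
    beta_reduce at h2
    linarith [le_abs_self R]
  · intro hl
    rw [Set.mem_ofPred_eq] at hl
    refine ⟨ne_of_lt hl, ?_⟩
    have hsub : connectedComponentIn Kᶜ l ⊆
        {l | ‖ellipseForm a c (l - b)‖ < ‖a‖ ^ 2 - ‖c‖ ^ 2} := by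
      intro z hz
      by_contra hzlt
      obtain ⟨y, hy, hy'⟩ := isPreconnected_connectedComponentIn.intermediate_value
        (mem_connectedComponentIn (F := Kᶜ) (ne_of_lt hl)) hz
        (continuous_norm_ellipseForm a b c).continuousOn ⟨hl.le, not_lt.1 hzlt⟩
      exact connectedComponentIn_subset _ _ hy hy'
    refine Bornology.IsBounded.subset ?_ hsub
    rw [isBounded_iff_forall_norm_le]
    refine ⟨‖a‖ + ‖c‖ + ‖b‖, fun z hz => ?_⟩
    rw [Set.mem_ofPred_eq] at hz
    have h1 := congrArg norm (add_conj_ellipseForm a c (z - b))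
    rw [norm_mul, Complex.norm_real, Real.norm_of_nonneg hpos.le] at h1
    have h2 : ‖a * ellipseForm a c (z - b) + c * conj (ellipseForm a c (z - b))‖ ≤
        (‖a‖ + ‖c‖) * (‖a‖ ^ 2 - ‖c‖ ^ 2) := by
      refine (norm_add_le _ _).trans ?_
      rw [norm_mul, norm_mul, RCLike.norm_conj, ← add_mul]
      gcongr
    rw [h1, mul_comm] at h2
    have h3 := le_of_mul_le_mul_right h2 hpos
    have h4 := norm_sub_norm_le z b
    linarith

lemma convex_ellipse (a b c : ℂ) (R : ℝ) : Convex ℝ {l : ℂ | ‖ellipseForm a c (l - b)‖ < R} := by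
  have : {l : ℂ | ‖ellipseForm a c (l - b)‖ < R} =
      (fun l => l - b) ⁻¹' ((ellipseForm a c : ℂ →ₗ[ℝ] ℂ) ⁻¹' Metric.ball 0 R) := by
    ext; simp
  rw [this]
  simp only [sub_eq_add_neg]
  exact ((convex_ball 0 R).linear_preimage _).translate_preimage_left _

lemma isOpen_ellipse (a b c : ℂ) (R : ℝ) : IsOpen {l : ℂ | ‖ellipseForm a c (l - b)‖ < R} :=
  isOpen_lt (continuous_norm_ellipseForm a b c) continuous_const

/-- If the interior of the ellipse misses the unit circle, then the whole closed ellipse lies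
either in the closed unit disc or outside the open one; in the second case the origin lies outside
the curve. -/
lemma ellipse_dichotomy {a c : ℂ} (hac : ‖c‖ < ‖a‖) (b : ℂ)
    (h : ¬ (curveInterior (Set.range (ellipticSymbol a b c)) ∩ Metric.sphere (0 : ℂ) 1).Nonempty) :
    (∀ t, ‖ellipticSymbol a b c t‖ ≤ 1) ∨
      ((∀ t, 1 ≤ ‖ellipticSymbol a b c t‖) ∧
        ‖a‖ ^ 2 - ‖c‖ ^ 2 < ‖ellipseForm a c (-b)‖) := by
  have hpos := sq_norm_sub_pos hac
  have hcl : ∀ t, ellipticSymbol a b c t ∈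
      closure {l | ‖ellipseForm a c (l - b)‖ < ‖a‖ ^ 2 - ‖c‖ ^ 2} := by
    intro t
    have ht : ‖ellipseForm a c (ellipticSymbol a b c t - b)‖ = ‖a‖ ^ 2 - ‖c‖ ^ 2 := by
      have : ellipticSymbol a b c t ∈ Set.range (ellipticSymbol a b c) := ⟨t, rfl⟩
      rwa [range_ellipticSymbol hac] at this
    have hlim : Filter.Tendsto (fun s : ℝ => b + s • (ellipticSymbol a b c t - b))
        (nhdsWithin 1 (Set.Ico 0 1)) (nhds (ellipticSymbol a b c t)) := by
      have : Continuous fun s : ℝ => b + s • (ellipticSymbol a b c t - b) := by fun_prop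
      have := this.tendsto 1
      rw [one_smul, add_sub_cancel] at this
      exact this.mono_left nhdsWithin_le_nhds
    have hne : (nhdsWithin (1 : ℝ) (Set.Ico 0 1)).NeBot :=
      mem_closure_iff_nhdsWithin_neBot.1 (by rw [closure_Ico (by norm_num)]; simp)
    refine mem_closure_of_tendsto hlim (Filter.eventually_of_mem self_mem_nhdsWithin fun s hs => ?_)
    rw [Set.mem_ofPred_eq, add_sub_cancel_left, map_smul, norm_smul, Real.norm_of_nonneg hs.1, ht]
    exact mul_lt_of_lt_one_left hpos hs.2
  rw [curveInterior_ellipticSymbol hac] at h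
  set E := {l | ‖ellipseForm a c (l - b)‖ < ‖a‖ ^ 2 - ‖c‖ ^ 2} with hE
  have hne : ∀ l ∈ E, ‖l‖ ≠ 1 := fun l hl h1 => h ⟨l, hl, by simpa using h1⟩
  have hEc : IsPreconnected E := (convex_ellipse a b c _).isPreconnected
  have hb : b ∈ E := by simpa [hE] using hpos
  have hside : (∀ l ∈ E, ‖l‖ ≤ 1) ∨ ∀ l ∈ E, 1 ≤ ‖l‖ := by
    by_contra! hcon
    obtain ⟨⟨x, hx, hx1⟩, y, hy, hy1⟩ := hcon
    obtain ⟨z, hz, hz1⟩ := hEc.intermediate_value hy hx continuous_norm.continuousOn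
      ⟨hy1.le, hx1.le⟩
    exact hne z hz hz1
  rcases hside with hs | hs
  · exact Or.inl fun t => closure_minimal (t := {l : ℂ | ‖l‖ ≤ 1}) hs
      (isClosed_le continuous_norm continuous_const) (hcl t)
  · have h1 : ∀ t, 1 ≤ ‖ellipticSymbol a b c t‖ := fun t =>
      closure_minimal (t := {l : ℂ | 1 ≤ ‖l‖}) hs
        (isClosed_le continuous_const continuous_norm) (hcl t)
    refine Or.inr ⟨h1, lt_of_le_of_ne ?_ fun h0 => ?_⟩
    · by_contra! hlt
      have := hs 0 (by rw [hE, Set.mem_ofPred_eq, zero_sub]; exact hlt)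
      norm_num at this
    · have : (0 : ℂ) ∈ Set.range (ellipticSymbol a b c) := by
        rw [range_ellipticSymbol hac, Set.mem_ofPred_eq, zero_sub, h0]
      obtain ⟨t, ht⟩ := this
      have := h1 t
      rw [ht] at this
      norm_num at this

/-! ### Fourier coefficients -/

lemma integrable_continuousMap (G : C(Torus, ℂ)) : Integrable G normLeb :=
  G.continuous.integrable_of_hasCompactSupport (HasCompactSupport.of_compactSpace _)

lemma integrable_continuousMap_mul {u : Torus → ℂ} (hu : Integrable u normLeb) (G : C(Torus, ℂ)) :
    Integrable (fun t => G t * u t) normLeb :=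
  hu.bdd_mul (c := ‖G‖) G.continuous.aestronglyMeasurable
    (Filter.Eventually.of_forall fun t => G.norm_coe_le_norm t)

lemma norm_coeffL_le (p : ℝ≥0∞) [Fact (1 ≤ p)] (n : ℤ) : ‖coeffL p n‖ ≤ 1 := by
  rw [coeffL]
  apply LinearMap.mkContinuous_norm_le _ zero_le_one

lemma norm_fourierCoeff_le (p : ℝ≥0∞) [Fact (1 ≤ p)] (u : Lp ℂ p normLeb) (n : ℤ) :
    ‖fourierCoeff u n‖ ≤ ‖u‖ := by
  have h := ContinuousLinearMap.le_of_opNorm_le (coeffL p n) (norm_coeffL_le p n) u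
  rwa [one_mul, coeffL_apply] at h

lemma fourierCoeff_symbol_mul (a b c : ℂ) (G : C(Torus, ℂ)) (n : ℤ) :
    fourierCoeff (ellipticSymbol a b c * G) n =
      a * fourierCoeff G (n + 1) + b * fourierCoeff G n + c * fourierCoeff G (n - 1) := by
  have hG : (ContinuousMap.toLp 1 normLeb ℂ G : Lp ℂ 1 normLeb) =ᵐ[normLeb] G :=
    ContinuousMap.coeFn_toLp (p := 1) (𝕜 := ℂ) normLeb G
  have h := fourierCoeff_symbol_smul 1 a b c (ContinuousMap.toLp 1 normLeb ℂ G) n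
  rw [fourierCoeff_congr_ae hG] at h
  have hFG : (ellipticSymbolLinfty a b c • ContinuousMap.toLp 1 normLeb ℂ G : Lp ℂ 1 normLeb)
      =ᵐ[normLeb] ellipticSymbol a b c * G := by
    filter_upwards [coeFn_symbol_smul 1 a b c (ContinuousMap.toLp 1 normLeb ℂ G), hG] with t h1 h2
    rw [h1, h2]
    rfl
  rw [← h, fourierCoeff_congr_ae hFG]
  rfl

lemma fourierCoeff_toeplitzElliptic (p : ℝ≥0∞) [Fact (1 ≤ p)] (a b c : ℂ) (u : hardySpace p)
    (n : ℕ) :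
    fourierCoeff (toeplitzElliptic p a b c u : Lp ℂ p normLeb) n =
      a * fourierCoeff (u : Lp ℂ p normLeb) (n + 1) + b * fourierCoeff (u : Lp ℂ p normLeb) n +
        c * fourierCoeff (u : Lp ℂ p normLeb) (n - 1) := by
  rw [← fourierCoeff_symbol_smul]
  exact isRieszProjection_toeplitz_elliptic p a b c u n (Int.natCast_nonneg n)

/-- The `n`-th Fourier coefficient as a functional on the Hardy space. -/
noncomputable def hardyCoeff (p : ℝ≥0∞) [Fact (1 ≤ p)] (n : ℤ) : hardySpace p →L[ℂ] ℂ :=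
  (coeffL p n).comp (hardySpace p).subtypeL

lemma norm_hardyCoeff_le (p : ℝ≥0∞) [Fact (1 ≤ p)] (n : ℤ) : ‖hardyCoeff p n‖ ≤ 1 :=
  ContinuousLinearMap.opNorm_le_bound _ zero_le_one fun u => by
    rw [one_mul]
    exact norm_fourierCoeff_le p u n

lemma hardyCoeff_toeplitzElliptic (p : ℝ≥0∞) [Fact (1 ≤ p)] (a b c : ℂ) (u : hardySpace p)
    (n : ℕ) :
    hardyCoeff p n (toeplitzElliptic p a b c u) =
      a * hardyCoeff p (n + 1) u + b * hardyCoeff p n u + c * hardyCoeff p (n - 1) u :=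
  fourierCoeff_toeplitzElliptic p a b c u n

/-- The monomial `zⁿ` as an element of the Hardy space. -/
noncomputable def monomial (p : ℝ≥0∞) [Fact (1 ≤ p)] (n : ℕ) : hardySpace p :=
  ⟨fourierLp p n, fun m hm => by rw [fourierCoeff_fourierLp, if_neg (by omega)]⟩

lemma hardyCoeff_monomial (p : ℝ≥0∞) [Fact (1 ≤ p)] (m : ℤ) (n : ℕ) :
    hardyCoeff p m (monomial p n) = if m = n then 1 else 0 :=
  fourierCoeff_fourierLp p n m

lemma norm_monomial_le (p : ℝ≥0∞) [Fact (1 ≤ p)] (n : ℕ) : ‖monomial p n‖ ≤ 1 := by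
  have h : ‖(fourierLp p n : Lp ℂ p normLeb)‖ ≤ _ :=
    Lp.norm_le_of_ae_bound (C := 1) zero_le_one (by
      filter_upwards [coeFn_fourierLp (T := 2 * π) p n] with t ht
      rw [ht, fourier_apply, Circle.norm_coe])
  have h1 : measureUnivNNReal normLeb = 1 := by simp [measureUnivNNReal]
  rw [h1, NNReal.coe_one, Real.one_rpow, one_mul] at h
  exact h

lemma hardySpace_ext {p : ℝ≥0∞} [Fact (1 ≤ p)] {u v : hardySpace p}
    (h : ∀ n : ℕ, hardyCoeff p n u = hardyCoeff p n v) : u = v := by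
  refine IsRieszProjection.unique (f := (v : Lp ℂ p normLeb)) (fun n hn => ?_) fun n _ => rfl
  obtain ⟨k, rfl⟩ := Int.eq_ofNat_of_zero_le hn
  exact h k

/-! ### The case `|a| < |c|`: eigenvectors of the adjoint -/

lemma summable_smul_of_norm_le {E : Type*} [NormedAddCommGroup E] [NormedSpace ℂ E]
    [CompleteSpace E] {d : ℕ → ℂ} (hd : Summable fun n => ‖d n‖) {e : ℕ → E} {C : ℝ}
    (he : ∀ n, ‖e n‖ ≤ C) (k : ℕ) : Summable fun n : ℕ => d (n + k) • e n := by
  refine Summable.of_norm_bounded (((summable_nat_add_iff k).2 hd).mul_right C) fun n => ?_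
  rw [norm_smul]
  exact mul_le_mul_of_nonneg_left (he n) (norm_nonneg _)

lemma hasSum_iff_of_eq {f g : ℕ → ℂ} {s : ℂ} (h : ∀ n, f n = g n) : HasSum f s ↔ HasSum g s := by
  rw [funext h]

/-- A summable solution of the recurrence `a dₙ + b dₙ₊₁ + c dₙ₊₂ = l dₙ₊₁` with `d₀ = 0` gives the
eigenvector `u ↦ ∑ dₙ₊₁ û(n)` of the adjoint of the Toeplitz operator. -/
theorem not_isHypercyclic_of_recurrence (p : ℝ≥0∞) [Fact (1 ≤ p)] {a b c l : ℂ} {d : ℕ → ℂ}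
    (hd : Summable fun n => ‖d n‖) (hd0 : d 0 = 0) (hd1 : d 1 ≠ 0)
    (h : ∀ n, a * d n + b * d (n + 1) + c * d (n + 2) = l * d (n + 1)) :
    ¬ IsHypercyclic (toeplitzElliptic p a b c) := by
  obtain ⟨φ, hφ⟩ := summable_smul_of_norm_le (E := hardySpace p →L[ℂ] ℂ)
    (e := fun n : ℕ => hardyCoeff p n) hd (fun n : ℕ => norm_hardyCoeff_le p n) 1
  have hφs : ∀ u, HasSum (fun n : ℕ => d (n + 1) * hardyCoeff p n u) (φ u) := fun u =>
    hφ.mapL (ContinuousLinearMap.apply ℂ ℂ u)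
  have hφ0 : φ ≠ 0 := by
    rintro rfl
    have h1 := (hφs (monomial p 0)).unique (hasSum_single 0 fun n hn => by
      rw [hardyCoeff_monomial, if_neg (by exact_mod_cast hn), mul_zero])
    rw [hardyCoeff_monomial, if_pos rfl, mul_one] at h1
    exact hd1 h1.symm
  refine not_isHypercyclic_of_adjoint_eigenvector _ hφ0 (l := l) fun u => ?_
  have hu : ∀ n : ℕ, ‖hardyCoeff p n u‖ ≤ ‖u‖ := fun n => norm_fourierCoeff_le p u n
  have hneg : hardyCoeff p (-1) u = 0 := u.2 (-1) (by norm_num)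
  obtain ⟨P, hP⟩ := summable_smul_of_norm_le hd hu 0
  obtain ⟨Q, hQ⟩ := summable_smul_of_norm_le hd hu 2
  -- Shifting the index costs no boundary term, because `d 0 = 0` and `û(-1) = 0`.
  have h0 : HasSum (fun n : ℕ => d (n + 1) * hardyCoeff p (n + 1) u) P := by
    have := (hasSum_nat_add_iff' 1).2 hP
    simpa [hd0] using this
  have h2 : HasSum (fun n : ℕ => d (n + 1) * hardyCoeff p (n - 1) u) Q := by
    rw [← hasSum_nat_add_iff' 1]
    simpa [hneg] using hQ
  have hT := ((h0.mul_left a).add ((hφs u).mul_left b)).add (h2.mul_left c)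
  have hR := ((hP.mul_left a).add ((hφs u).mul_left b)).add (hQ.mul_left c)
  have e1 : φ (toeplitzElliptic p a b c u) = a * P + b * φ u + c * Q := by
    refine (hφs _).unique ((hasSum_iff_of_eq fun n => ?_).2 hT)
    rw [hardyCoeff_toeplitzElliptic]
    ring
  have e2 : l * φ u = a * P + b * φ u + c * Q := by
    refine ((hφs u).mul_left l).unique ((hasSum_iff_of_eq fun n => ?_).2 hR)
    rw [smul_eq_mul, smul_eq_mul, add_zero]
    linear_combination - hardyCoeff p n u * h n
  rw [e1, e2]

lemma exists_mul_eq_of_norm_lt {a c : ℂ} (hac : ‖a‖ < ‖c‖) :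
    ∃ x y : ℂ, ‖y‖ < ‖x‖ ∧ ‖x‖ < 1 ∧ c * (x * y) = a := by
  have hc : c ≠ 0 := norm_pos_iff.1 ((norm_nonneg a).trans_lt hac)
  have hs : ‖a / c‖ < 1 := by
    rw [norm_div, div_lt_one (norm_pos_iff.2 hc)]
    exact hac
  -- Any `x` with `|a / c| < |x| < 1` and `x² ≠ a / c` would do.
  let x : ℂ := (((1 + ‖a / c‖) / 2 : ℝ) : ℂ)
  have hnx : ‖x‖ = (1 + ‖a / c‖) / 2 := by
    rw [Complex.norm_real, Real.norm_of_nonneg (by positivity)]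
  have hx0 : x ≠ 0 := norm_pos_iff.1 (by rw [hnx]; positivity)
  have hx1 : ‖x‖ < 1 := by rw [hnx]; linarith
  let y : ℂ := a / c / x
  have hxy : c * (x * y) = a := by simp only [y]; field_simp
  have hny : ‖y‖ < ‖x‖ := by
    rw [norm_div, div_lt_iff₀ (norm_pos_iff.2 hx0), hnx]
    nlinarith [sq_nonneg (1 - ‖a / c‖)]
  exact ⟨x, y, hny, hx1, hxy⟩

/-- For `|a| < |c|` the sequence `xⁿ - yⁿ` with `c x y = a` gives an eigenvector of the adjoint. -/
theorem not_isHypercyclic_of_norm_lt (p : ℝ≥0∞) [Fact (1 ≤ p)] {a c : ℂ} (b : ℂ)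
    (hac : ‖a‖ < ‖c‖) : ¬ IsHypercyclic (toeplitzElliptic p a b c) := by
  obtain ⟨x, y, hyx, hx, hxy⟩ := exists_mul_eq_of_norm_lt hac
  have hg : ∀ z : ℂ, ‖z‖ < 1 → Summable fun n : ℕ => ‖z ^ n‖ := fun z hz => by
    simpa only [norm_pow] using summable_geometric_of_lt_one (norm_nonneg z) hz
  refine not_isHypercyclic_of_recurrence p (d := fun n => x ^ n - y ^ n)
    (l := b + c * (x + y)) ?_ ?_ ?_ ?_
  · exact Summable.of_nonneg_of_le (fun n => norm_nonneg _) (fun n => norm_sub_le _ _)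
      ((hg x hx).add (hg y (hyx.trans hx)))
  · simp
  · intro h
    rw [pow_one, pow_one, sub_eq_zero] at h
    rw [h] at hyx
    exact lt_irrefl _ hyx
  · intro n
    simp only [← hxy]
    ring

/-! ### Symmetric weights and bounded functionals along orbits -/

/-- A continuous function is `r`-symmetric if `Ĝ(k) = rᵏ Ĝ(-k)` for all `k ≥ 0`; for `r ≠ 0`
this is the formal invariance of the Laurent series of `G` under `z ↦ 1 / (r z)`. With `r = c / a`
this is the symmetry of `a z⁻¹ + b + c z`. -/
def IsSymmetricWeight (r : ℂ) (G : C(Torus, ℂ)) : Prop :=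
  ∀ k : ℕ, fourierCoeff G k = r ^ k * fourierCoeff G (-k)

lemma isSymmetricWeight_one (r : ℂ) : IsSymmetricWeight r 1 := by
  intro k
  have h1 : (1 : C(Torus, ℂ)) = fourier 0 := by ext; simp
  rw [h1, fourierCoeff_fourier]
  rcases Nat.eq_zero_or_pos k with rfl | hk
  · simp
  · rw [Pi.single_eq_of_ne (by exact_mod_cast hk.ne'),
      Pi.single_eq_of_ne (by rw [neg_ne_zero]; exact_mod_cast hk.ne'), mul_zero]

/-- The defects `Ĝ(k) - rᵏ Ĝ(-k)` of `G` and `F G` are related by the three-term recurrence of the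
symbol. -/
lemma symmetryDefect_symbol_mul {a b c r : ℂ} (hr : a * r = c) (G : C(Torus, ℂ)) (k : ℕ) :
    fourierCoeff (ellipticSymbol a b c * G) (k + 1 : ℕ) -
        r ^ (k + 1) * fourierCoeff (ellipticSymbol a b c * G) (-(k + 1 : ℕ)) =
      a * (fourierCoeff G (k + 2 : ℕ) - r ^ (k + 2) * fourierCoeff G (-(k + 2 : ℕ))) +
        b * (fourierCoeff G (k + 1 : ℕ) - r ^ (k + 1) * fourierCoeff G (-(k + 1 : ℕ))) +
        c * (fourierCoeff G k - r ^ k * fourierCoeff G (-k)) := by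
  have e1 : ((k + 1 : ℕ) : ℤ) + 1 = (k + 2 : ℕ) := by push_cast; ring
  have e2 : ((k + 1 : ℕ) : ℤ) - 1 = k := by push_cast; ring
  have e3 : -((k + 1 : ℕ) : ℤ) + 1 = -k := by push_cast; ring
  have e4 : -((k + 1 : ℕ) : ℤ) - 1 = -(k + 2 : ℕ) := by push_cast; ring
  rw [fourierCoeff_symbol_mul, fourierCoeff_symbol_mul, e1, e2, e3, e4, ← hr]
  ring

lemma IsSymmetricWeight.symbol_mul {a b c r : ℂ} (hr : a * r = c) {G : C(Torus, ℂ)}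
    (hG : IsSymmetricWeight r G) : IsSymmetricWeight r (ellipticSymbol a b c * G) := by
  intro k
  rcases k with _ | k
  · simp
  · rw [← sub_eq_zero, symmetryDefect_symbol_mul hr, sub_eq_zero.2 (hG k),
      sub_eq_zero.2 (hG (k + 1)), sub_eq_zero.2 (hG (k + 2))]
    simp

lemma norm_fourierCoeff_continuousMap_le (G : C(Torus, ℂ)) (n : ℤ) : ‖fourierCoeff G n‖ ≤ ‖G‖ := by
  have h : ‖∫ t, fourier (-n) t • G t ∂normLeb‖ ≤ ‖G‖ * normLeb.real Set.univ :=
    norm_integral_le_of_norm_le_const (Filter.Eventually.of_forall fun t => by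
      rw [norm_smul, fourier_apply, Circle.norm_coe, one_mul]
      exact G.norm_coe_le_norm t)
  rwa [probReal_univ, mul_one] at h

/-- A bounded solution of `a dₖ₊₂ + b dₖ₊₁ + c dₖ = 0` with `d₀ = 0` vanishes as soon as one
characteristic root `x` has modulus greater than one, since `dₖ₊₁ - y dₖ = xᵏ d₁`. -/
lemma eq_zero_of_bounded_recurrence {a b c x y : ℂ} (ha : a ≠ 0) (hb : a * (x + y) = -b)
    (hc : a * (x * y) = c) (hx : 1 < ‖x‖) {d : ℕ → ℂ} (hd0 : d 0 = 0) {C : ℝ}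
    (hC : ∀ k, ‖d k‖ ≤ C) (h : ∀ k, a * d (k + 2) + b * d (k + 1) + c * d k = 0) (k : ℕ) :
    d k = 0 := by
  have h1 : ∀ k, d (k + 1) - y * d k = x ^ k * d 1 := by
    intro k
    induction k with
    | zero => simp [hd0]
    | succ k ih =>
      have : a * (d (k + 2) - y * d (k + 1)) = a * (x ^ (k + 1) * d 1) := by
        rw [pow_succ, mul_assoc _ x, mul_left_comm _ x, ← ih]
        linear_combination h k - d (k + 1) * hb + d k * hc
      exact mul_left_cancel₀ ha this
  have hd1 : d 1 = 0 := by
    by_contra hne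
    have hlim := (tendsto_pow_atTop_atTop_of_one_lt hx).atTop_mul_const (norm_pos_iff.2 hne)
    obtain ⟨n, hn⟩ := (hlim.eventually_gt_atTop (C + ‖y‖ * C)).exists
    rw [← norm_pow, ← norm_mul, ← h1] at hn
    have h2 := norm_sub_le (d (n + 1)) (y * d n)
    rw [norm_mul] at h2
    have h3 := mul_le_mul_of_nonneg_left (hC n) (norm_nonneg y)
    linarith [hC (n + 1)]
  induction k with
  | zero => exact hd0
  | succ k ih =>
    have := h1 k
    rwa [ih, hd1, mul_zero, mul_zero, sub_zero] at this

/-- If the origin lies outside the ellipse, symmetry also passes from `F G` to `G`. -/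
lemma IsSymmetricWeight.of_symbol_mul {a b c r : ℂ} (hac : ‖c‖ < ‖a‖) (hr : a * r = c)
    (h0 : ‖a‖ ^ 2 - ‖c‖ ^ 2 < ‖ellipseForm a c (-b)‖) {G : C(Torus, ℂ)}
    (hG : IsSymmetricWeight r (ellipticSymbol a b c * G)) : IsSymmetricWeight r G := by
  have ha : a ≠ 0 := norm_pos_iff.1 ((norm_nonneg c).trans_lt hac)
  obtain ⟨x, y, hb, hc, hx⟩ := exists_root_one_lt_norm hac h0
  have hr1 : ‖r‖ ≤ 1 := by
    have := congrArg norm hr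
    rw [norm_mul] at this
    by_contra! hlt
    nlinarith [norm_nonneg a]
  intro k
  rw [← sub_eq_zero]
  refine eq_zero_of_bounded_recurrence ha hb hc hx
    (d := fun k : ℕ => fourierCoeff G k - r ^ k * fourierCoeff G (-k)) (C := ‖G‖ + ‖G‖)
    (by simp) (fun k => ?_) (fun k => ?_) k
  · refine (norm_sub_le _ _).trans (add_le_add (norm_fourierCoeff_continuousMap_le G k) ?_)
    rw [norm_mul, norm_pow]
    exact (mul_le_of_le_one_left (norm_nonneg _) (pow_le_one₀ (norm_nonneg _) hr1)).trans
      (norm_fourierCoeff_continuousMap_le G _)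
  · rw [← symmetryDefect_symbol_mul hr, sub_eq_zero.2 (hG (k + 1))]

/-- The functional `f ↦ f̂(0) - r f̂(-2)` applied to `G u`. It is chosen to vanish on `G e^{-iθ}`
for every `r`-symmetric `G`, and to coincide with `û(0)` when `G = 1` and `u` is in the Hardy
space. -/
noncomputable def weightedCoeff (r : ℂ) (G : C(Torus, ℂ)) (u : Torus → ℂ) : ℂ :=
  fourierCoeff (fun t => G t * u t) 0 - r * fourierCoeff (fun t => G t * u t) (-2)

lemma norm_fourierCoeff_mul_le {p : ℝ≥0∞} [Fact (1 ≤ p)] (G : C(Torus, ℂ)) {M : ℝ}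
    (hG : ∀ t, ‖G t‖ ≤ M) (u : Lp ℂ p normLeb) (n : ℤ) :
    ‖fourierCoeff (fun t => G t * u t) n‖ ≤ M * ‖u‖ := by
  have hu := integrable_of_Lp p u
  have h2 : ∫ t, ‖u t‖ ∂normLeb ≤ ‖u‖ := by
    rw [integral_norm_eq_lintegral_enorm (Lp.aestronglyMeasurable u), Lp.norm_def,
      ← eLpNorm_one_eq_lintegral_enorm]
    exact ENNReal.toReal_mono (Lp.eLpNorm_ne_top u)
      (eLpNorm_le_eLpNorm_of_exponent_le Fact.out (Lp.aestronglyMeasurable u))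
  have hM : 0 ≤ M := (norm_nonneg _).trans (hG 0)
  refine (norm_integral_le_integral_norm _).trans ?_
  refine (integral_mono_of_nonneg (Filter.Eventually.of_forall fun t => norm_nonneg _)
    (hu.norm.const_mul M) (Filter.Eventually.of_forall fun t => ?_)).trans ?_
  · beta_reduce
    rw [norm_smul, norm_mul, fourier_apply, Circle.norm_coe, one_mul]
    exact mul_le_mul_of_nonneg_right (hG t) (norm_nonneg _)
  · rw [integral_const_mul]
    exact mul_le_mul_of_nonneg_left h2 hM

lemma norm_weightedCoeff_le {p : ℝ≥0∞} [Fact (1 ≤ p)] {r : ℂ} (hr : ‖r‖ ≤ 1) (G : C(Torus, ℂ))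
    (hG : ∀ t, ‖G t‖ ≤ 1) (u : Lp ℂ p normLeb) : ‖weightedCoeff r G u‖ ≤ 2 * ‖u‖ := by
  have h0 := norm_fourierCoeff_mul_le G hG u 0
  have h2 := norm_fourierCoeff_mul_le G hG u (-2)
  refine (norm_sub_le _ _).trans ?_
  rw [norm_mul]
  have := mul_le_of_le_one_left (norm_nonneg (fourierCoeff (fun t => G t * u t) (-2))) hr
  linarith

lemma weightedCoeff_one (p : ℝ≥0∞) [Fact (1 ≤ p)] (r : ℂ) (u : hardySpace p) :
    weightedCoeff r 1 (u : Lp ℂ p normLeb) = hardyCoeff p 0 u := by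
  have h : (fun t => (1 : C(Torus, ℂ)) t * (u : Lp ℂ p normLeb) t) = (u : Lp ℂ p normLeb) := by
    ext t; simp
  rw [weightedCoeff, h, u.2 (-2) (by norm_num), mul_zero, sub_zero]
  rfl

lemma fourierCoeff_mul_toeplitzElliptic (p : ℝ≥0∞) [Fact (1 ≤ p)] (a b c : ℂ) (G : C(Torus, ℂ))
    (u : hardySpace p) (n : ℤ) :
    fourierCoeff (fun t => G t * (toeplitzElliptic p a b c u : Lp ℂ p normLeb) t) n =
      fourierCoeff (fun t => (ellipticSymbol a b c * G) t * (u : Lp ℂ p normLeb) t) n -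
        a * fourierCoeff (u : Lp ℂ p normLeb) 0 * fourierCoeff G (n + 1) := by
  have hT : ((toeplitzElliptic p a b c u : hardySpace p) : Lp ℂ p normLeb) =
      (ellipticSymbolLinfty a b c • (u : Lp ℂ p normLeb) : Lp ℂ p normLeb) -
        (a * fourierCoeff (u : Lp ℂ p normLeb) 0) • fourierLp p (-1) :=
    coe_toeplitz_elliptic p a b c u
  set A : ℂ := a * fourierCoeff (u : Lp ℂ p normLeb) 0
  have hae : (fun t => G t * (toeplitzElliptic p a b c u : Lp ℂ p normLeb) t) =ᵐ[normLeb]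
      fun t => (ellipticSymbol a b c * G) t * (u : Lp ℂ p normLeb) t -
        A * (fourier (-1) t * G t) := by
    rw [hT]
    filter_upwards [Lp.coeFn_sub
      (ellipticSymbolLinfty a b c • (u : Lp ℂ p normLeb) : Lp ℂ p normLeb)
      (A • fourierLp p (-1)), coeFn_symbol_smul p a b c (u : Lp ℂ p normLeb),
      Lp.coeFn_smul A (fourierLp p (-1) : Lp ℂ p normLeb), coeFn_fourierLp (T := 2 * π) p (-1)]
      with t h1 h2 h3 h4
    rw [h1, Pi.sub_apply, h2, h3, Pi.smul_apply, h4, smul_eq_mul, ContinuousMap.mul_apply]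
    ring
  rw [fourierCoeff_congr_ae hae]
  have i1 := (integrable_continuousMap_mul (integrable_of_Lp p (u : Lp ℂ p normLeb))
    (ellipticSymbol a b c * G)).fourier_smul (-n)
  have i2 : Integrable (fun t => A * (fourier (-(n + 1)) t * G t)) normLeb :=
    ((integrable_continuousMap G).fourier_smul (-(n + 1))).const_mul A
  simp only [fourierCoeff]
  rw [← integral_const_mul]
  simp only [smul_eq_mul] at i1 ⊢
  rw [← integral_sub i1 i2]
  refine integral_congr_ae (Filter.Eventually.of_forall fun t => ?_)
  have e1 : (fourier (-(n + 1)) t : ℂ) = fourier (-n) t * fourier (-1) t := by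
    rw [← fourier_add]; congr 2; ring
  simp only [e1]
  ring

/-- Since `T u = F u - a û(0) e^{-iθ}` and the functional vanishes on `G e^{-iθ}`, the operator can
be traded for a factor `F` of the weight. -/
lemma weightedCoeff_toeplitzElliptic (p : ℝ≥0∞) [Fact (1 ≤ p)] {a b c r : ℂ} {G : C(Torus, ℂ)}
    (hG : IsSymmetricWeight r G) (u : hardySpace p) :
    weightedCoeff r G (toeplitzElliptic p a b c u : Lp ℂ p normLeb) =
      weightedCoeff r (ellipticSymbol a b c * G) (u : Lp ℂ p normLeb) := by
  have h1 := hG 1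
  rw [Nat.cast_one, pow_one] at h1
  rw [weightedCoeff, fourierCoeff_mul_toeplitzElliptic, fourierCoeff_mul_toeplitzElliptic,
    weightedCoeff, zero_add, show (-2 : ℤ) + 1 = -1 by norm_num, h1]
  ring

lemma weightedCoeff_toeplitzElliptic_pow (p : ℝ≥0∞) [Fact (1 ≤ p)] {a b c r : ℂ} (hr : a * r = c)
    (n : ℕ) {G : C(Torus, ℂ)} (hG : IsSymmetricWeight r G) (u : hardySpace p) :
    weightedCoeff r G ((toeplitzElliptic p a b c ^ n) u : hardySpace p) =
      weightedCoeff r (ellipticSymbol a b c ^ n * G) (u : Lp ℂ p normLeb) := by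
  induction n generalizing G with
  | zero => simp
  | succ n ih =>
    rw [pow_succ', mul_apply_eq_comp, weightedCoeff_toeplitzElliptic p hG, ih (hG.symbol_mul hr),
      pow_succ, mul_assoc]

lemma hardyCoeff_zero_ne_zero (p : ℝ≥0∞) [Fact (1 ≤ p)] : hardyCoeff p 0 ≠ 0 := by
  intro h
  have h1 := hardyCoeff_monomial p 0 0
  rw [h] at h1
  simp at h1

/-- If `|F| ≤ 1` on the circle, then `û(0)` stays bounded along every orbit. -/
theorem not_isHypercyclic_of_symbol_le_one (p : ℝ≥0∞) [Fact (1 ≤ p)] {a b c : ℂ}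
    (hac : ‖c‖ < ‖a‖) (h : ∀ t, ‖ellipticSymbol a b c t‖ ≤ 1) :
    ¬ IsHypercyclic (toeplitzElliptic p a b c) := by
  have ha : 0 < ‖a‖ := (norm_nonneg c).trans_lt hac
  have hr : ‖c / a‖ ≤ 1 := by rw [norm_div, div_le_one ha]; exact hac.le
  refine not_isHypercyclic_of_bounded_functional _ (hardyCoeff_zero_ne_zero p) (C := 2)
    fun u n => ?_
  rw [← weightedCoeff_one p (c / a), weightedCoeff_toeplitzElliptic_pow p
    (mul_div_cancel₀ c (norm_pos_iff.1 ha)) n (isSymmetricWeight_one _)]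
  refine norm_weightedCoeff_le hr _ (fun t => ?_) _
  rw [mul_one, ContinuousMap.pow_apply, norm_pow]
  exact pow_le_one₀ (norm_nonneg _) (h t)

/-- If `|F| ≥ 1` on the circle and the origin lies outside the curve, then the powers of `1 / F` are
symmetric weights, and `|û(0)| ≤ 2 ‖Tⁿ u‖`. -/
theorem not_isHypercyclic_of_one_le_symbol (p : ℝ≥0∞) [Fact (1 ≤ p)] {a b c : ℂ}
    (hac : ‖c‖ < ‖a‖) (h : ∀ t, 1 ≤ ‖ellipticSymbol a b c t‖)
    (h0 : ‖a‖ ^ 2 - ‖c‖ ^ 2 < ‖ellipseForm a c (-b)‖) :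
    ¬ IsHypercyclic (toeplitzElliptic p a b c) := by
  have ha : 0 < ‖a‖ := (norm_nonneg c).trans_lt hac
  have hr : ‖c / a‖ ≤ 1 := by rw [norm_div, div_le_one ha]; exact hac.le
  have hr' : a * (c / a) = c := mul_div_cancel₀ c (norm_pos_iff.1 ha)
  have hne : ∀ t, ellipticSymbol a b c t ≠ 0 := fun t h0 => by
    have := h t
    rw [h0, norm_zero] at this
    linarith
  let J : C(Torus, ℂ) := ⟨fun t => (ellipticSymbol a b c t)⁻¹,
    (ellipticSymbol a b c).continuous.inv₀ hne⟩
  have hJ : ellipticSymbol a b c * J = 1 := by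
    ext t
    exact mul_inv_cancel₀ (hne t)
  have hsym : ∀ n : ℕ, IsSymmetricWeight (c / a) (J ^ n) := by
    intro n
    induction n with
    | zero => exact isSymmetricWeight_one _
    | succ n ih =>
      refine IsSymmetricWeight.of_symbol_mul hac hr' h0 ?_
      rwa [pow_succ', ← mul_assoc, hJ, one_mul]
  refine not_isHypercyclic_of_functional_le _ (hardyCoeff_zero_ne_zero p) (C := 2) fun u n => ?_
  have e := weightedCoeff_toeplitzElliptic_pow p (b := b) hr' n (hsym n) u
  rw [← mul_pow, hJ, one_pow, weightedCoeff_one] at e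
  rw [← e]
  refine norm_weightedCoeff_le hr _ (fun t => ?_) _
  rw [ContinuousMap.pow_apply, norm_pow]
  refine pow_le_one₀ (norm_nonneg _) ?_
  change ‖(ellipticSymbol a b c t)⁻¹‖ ≤ 1
  rw [norm_inv]
  exact inv_le_one_of_one_le₀ (h t)

/-! ### Density of the monomials in the Hardy space -/

lemma fourierCoeff_vadd (p : ℝ≥0∞) [Fact (1 ≤ p)] (t : Torus) (u : Lp ℂ p normLeb) (n : ℤ) :
    fourierCoeff (DomAddAct.mk t +ᵥ u : Lp ℂ p normLeb) n = fourier n t * fourierCoeff u n := by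
  rw [fourierCoeff_congr_ae (DomAddAct.vadd_Lp_ae_eq _ _)]
  simp only [fourierCoeff, smul_eq_mul, Equiv.symm_apply_apply, vadd_eq_add]
  rw [← integral_add_left_eq_self (fun s => (fourier (-n) s : ℂ) * u s) t, ← integral_const_mul]
  refine integral_congr_ae (Filter.Eventually.of_forall fun s => ?_)
  have h1 : (fourier (-n) (t + s) : ℂ) = fourier (-n) t * fourier (-n) s := by
    simp only [fourier_apply, smul_add, AddCircle.toCircle_add, Circle.coe_mul]
  have h2 : (fourier n t : ℂ) * fourier (-n) t = 1 := by
    rw [← fourier_add, add_neg_cancel, fourier_zero]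
  beta_reduce
  rw [h1]
  linear_combination - (fourier (-n) s : ℂ) * u (t + s) * h2

/-- Averaging the translates of `u ∈ Lᵖ` against a character gives `û(n) e^{inθ}`. -/
lemma integral_fourier_smul_vadd (p : ℝ≥0∞) [Fact (1 ≤ p)] [Fact (p ≠ ∞)] (u : Lp ℂ p normLeb)
    (n : ℤ) :
    Integrable (fun t : Torus => (fourier (-n) t : ℂ) • (DomAddAct.mk t +ᵥ u)) normLeb ∧
    ∫ t, (fourier (-n) t : ℂ) • (DomAddAct.mk t +ᵥ u) ∂normLeb =
      fourierCoeff u n • (fourierLp p n : Lp ℂ p normLeb) := by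
  have hcont : Continuous fun t : Torus => (fourier (-n) t : ℂ) • (DomAddAct.mk t +ᵥ u) := by
    refine (map_continuous (fourier (-n) : C(Torus, ℂ))).smul ?_
    exact (DomAddAct.continuous_mk.vadd continuous_const)
  have hi : Integrable (fun t : Torus => (fourier (-n) t : ℂ) • (DomAddAct.mk t +ᵥ u)) normLeb :=
    hcont.integrable_of_hasCompactSupport (HasCompactSupport.of_compactSpace _)
  refine ⟨hi, ?_⟩
  rw [← sub_eq_zero, Lp.eq_zero_iff_ae_eq_zero]
  refine ae_zero_of_fourierCoeff (integrable_of_Lp p _) fun m => ?_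
  rw [← coeffL_apply p, map_sub, map_smul, ← (coeffL p m).integral_comp_comm hi, coeffL_apply,
    fourierCoeff_fourierLp]
  have h1 : ∀ t : Torus, coeffL p m ((fourier (-n) t : ℂ) • (DomAddAct.mk t +ᵥ u)) =
      fourierCoeff u m * (fourier (-n) t • fourier m t) := fun t => by
    rw [map_smul, coeffL_apply, fourierCoeff_vadd, smul_eq_mul, smul_eq_mul]
    ring
  have h2 : ∫ t, (fourier (-n) t : ℂ) • (fourier m t : ℂ) ∂normLeb = if m = n then 1 else 0 := by
    have := congrFun (fourierCoeff_fourier (T := 2 * π) m) n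
    rw [fourierCoeff] at this
    rw [this, Pi.single_apply]
    simp only [eq_comm]
  simp only [h1]
  rw [integral_const_mul, h2]
  split_ifs with h
  · rw [h]; simp
  · simp

/-- A functional on `Hᵖ`, `p < ∞`, that vanishes on the monomials is zero. For an extension `ψ` to
`Lᵖ`, all Fourier coefficients of the continuous function `t ↦ ψ(u(· + t))` vanish. -/
theorem functional_eq_zero_of_monomial (p : ℝ≥0∞) [Fact (1 ≤ p)] [Fact (p ≠ ∞)]
    (φ : hardySpace p →L[ℂ] ℂ) (h : ∀ n, φ (monomial p n) = 0) : φ = 0 := by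
  obtain ⟨ψ, hψ, -⟩ := exists_extension_norm_eq (𝕜 := ℂ) (hardySpace p) φ
  ext u
  let g : Torus → ℂ := fun t => ψ (DomAddAct.mk t +ᵥ (u : Lp ℂ p normLeb))
  have hg : Continuous g :=
    ψ.continuous.comp (DomAddAct.continuous_mk.vadd continuous_const)
  have hgi : Integrable g normLeb :=
    hg.integrable_of_hasCompactSupport (HasCompactSupport.of_compactSpace _)
  have hz : g =ᵐ[normLeb] 0 := by
    refine ae_zero_of_fourierCoeff hgi fun n => ?_
    obtain ⟨hi, he⟩ := integral_fourier_smul_vadd p (u : Lp ℂ p normLeb) n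
    have e : fourierCoeff g n =
        ψ (fourierCoeff (u : Lp ℂ p normLeb) n • (fourierLp p n : Lp ℂ p normLeb)) := by
      rw [← he, ← ψ.integral_comp_comm hi, fourierCoeff]
      simp only [map_smul, g]
    rw [e, map_smul]
    rcases lt_or_ge n 0 with hn | hn
    · rw [u.2 n hn, zero_smul]
    · obtain ⟨k, rfl⟩ := Int.eq_ofNat_of_zero_le hn
      have : ψ (fourierLp p (k : ℤ) : Lp ℂ p normLeb) = φ (monomial p k) := hψ (monomial p k)
      rw [this, h k, smul_zero]
  have h0 : g = 0 := (hg.ae_eq_iff_eq normLeb continuous_zero).1 hz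
  have h1 := congrFun h0 0
  simp only [g, DomAddAct.mk_zero, zero_vadd] at h1
  rw [hψ] at h1
  exact h1

/-! ### Eigenvectors -/

lemma isClosed_hardySpace (p : ℝ≥0∞) [Fact (1 ≤ p)] :
    IsClosed (hardySpace p : Set (Lp ℂ p normLeb)) := by
  have : (hardySpace p : Set (Lp ℂ p normLeb)) = ⋂ n : ℤ, ⋂ _ : n < 0, {u | coeffL p n u = 0} := by
    ext u
    simp only [Set.mem_iInter]
    rfl
  rw [this]
  exact isClosed_iInter fun n => isClosed_iInter fun _ =>
    isClosed_eq (coeffL p n).continuous continuous_const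

/-- For `|z| < 1` the function `w ↦ ∑ zⁿ⁺¹ wⁿ = z / (1 - z w)` of the Hardy space. The factor `z`
makes the vector vanish at `z = 0`, which lets the case `c = 0` be treated like the others. -/
noncomputable def kernelVector (p : ℝ≥0∞) [Fact (1 ≤ p)] (z : ℂ) : hardySpace p :=
  ∑' n : ℕ, z ^ (n + 1) • monomial p n

lemma summable_norm_pow {z : ℂ} (hz : ‖z‖ < 1) : Summable fun n : ℕ => ‖z ^ n‖ := by
  simpa only [norm_pow] using summable_geometric_of_lt_one (norm_nonneg z) hz

lemma hasSum_kernelVector (p : ℝ≥0∞) [Fact (1 ≤ p)] {z : ℂ} (hz : ‖z‖ < 1) :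
    HasSum (fun n : ℕ => z ^ (n + 1) • monomial p n) (kernelVector p z) := by
  have : CompleteSpace (hardySpace p) := (isClosed_hardySpace p).completeSpace_coe
  exact (summable_smul_of_norm_le (E := hardySpace p) (summable_norm_pow hz)
    (norm_monomial_le p) 1).hasSum

lemma hasSum_functional_kernelVector (p : ℝ≥0∞) [Fact (1 ≤ p)] {z : ℂ} (hz : ‖z‖ < 1)
    (φ : hardySpace p →L[ℂ] ℂ) :
    HasSum (fun n : ℕ => z ^ (n + 1) * φ (monomial p n)) (φ (kernelVector p z)) := by
  have := (hasSum_kernelVector p hz).mapL φ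
  simpa only [map_smul, smul_eq_mul] using this

lemma hardyCoeff_kernelVector (p : ℝ≥0∞) [Fact (1 ≤ p)] {z : ℂ} (hz : ‖z‖ < 1) (k : ℕ) :
    hardyCoeff p k (kernelVector p z) = z ^ (k + 1) := by
  refine (hasSum_functional_kernelVector p hz (hardyCoeff p k)).unique ?_
  have h := hasSum_single (f := fun n : ℕ => z ^ (n + 1) * hardyCoeff p k (monomial p n)) k
    fun n hn => by rw [hardyCoeff_monomial, if_neg (by exact_mod_cast hn.symm), mul_zero]
  rwa [hardyCoeff_monomial, if_pos rfl, mul_one] at h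

/-- With `a x y = c`, the difference of the vectors belonging to `x` and `y` is an eigenvector: it
is a multiple of `w ↦ 1 / ((1 - x w) (1 - y w))`. -/
lemma toeplitzElliptic_kernelVector_sub (p : ℝ≥0∞) [Fact (1 ≤ p)] {a c x y : ℂ} (b : ℂ)
    (hx : ‖x‖ < 1) (hy : ‖y‖ < 1) (hc : a * (x * y) = c) :
    toeplitzElliptic p a b c (kernelVector p x - kernelVector p y) =
      (b + a * (x + y)) • (kernelVector p x - kernelVector p y) := by
  refine hardySpace_ext fun k => ?_
  have h : ∀ k : ℕ, hardyCoeff p k (kernelVector p x - kernelVector p y) =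
      x ^ (k + 1) - y ^ (k + 1) := fun k => by
    rw [map_sub, hardyCoeff_kernelVector p hx, hardyCoeff_kernelVector p hy]
  have hpred : hardyCoeff p ((k : ℤ) - 1) (kernelVector p x - kernelVector p y) =
      x ^ k - y ^ k := by
    rcases k with _ | k
    · rw [pow_zero, pow_zero, sub_self]
      exact (kernelVector p x - kernelVector p y).2 _ (by norm_num)
    · rw [← h k]
      congr 2
      push_cast
      ring
  have hsucc : hardyCoeff p ((k : ℤ) + 1) (kernelVector p x - kernelVector p y) =
      x ^ (k + 2) - y ^ (k + 2) := h (k + 1)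
  rw [hardyCoeff_toeplitzElliptic, map_smul, h, hpred, hsucc, ← hc, smul_eq_mul]
  ring

/-! ### Uniqueness of symmetric power series -/

lemma isPreconnected_annulus (s : ℝ) (hs : 0 ≤ s) : IsPreconnected {z : ℂ | s < ‖z‖ ∧ ‖z‖ < 1} := by
  have h : {z : ℂ | s < ‖z‖ ∧ ‖z‖ < 1} =
      (fun q : ℝ × ℝ => (q.1 : ℂ) * Complex.exp (q.2 * Complex.I)) ''
        (Set.Ioo s 1 ×ˢ Set.univ) := by
    ext z
    constructor
    · intro hz
      exact ⟨(‖z‖, Complex.arg z), ⟨hz, Set.mem_univ _⟩, Complex.norm_mul_exp_arg_mul_I z⟩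
    · rintro ⟨⟨ρ, t⟩, ⟨hρ, -⟩, rfl⟩
      have : ‖(ρ : ℂ) * Complex.exp (t * Complex.I)‖ = ρ := by
        rw [norm_mul, Complex.norm_exp_ofReal_mul_I, mul_one, Complex.norm_real,
          Real.norm_of_nonneg (hs.trans hρ.1.le)]
      simpa only [Set.mem_ofPred_eq, this, Set.mem_Ioo] using hρ
  rw [h]
  exact (isPreconnected_Ioo.prod isPreconnected_univ).image _ (by fun_prop)

lemma analyticOnNhd_of_hasSum {d : ℕ → ℂ} {C : ℝ} (hd : ∀ n, ‖d n‖ ≤ C) {f : ℂ → ℂ}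
    (hf : ∀ z, ‖z‖ < 1 → HasSum (fun n : ℕ => z ^ (n + 1) * d n) (f z)) :
    AnalyticOnNhd ℂ f (Metric.ball 0 1) := by
  refine DifferentiableOn.analyticOnNhd (fun z hz => ?_) Metric.isOpen_ball
  rw [mem_ball_zero_iff] at hz
  obtain ⟨ρ, hzρ, hρ⟩ := exists_between hz
  have hρ0 : 0 ≤ ρ := (norm_nonneg z).trans hzρ.le
  have hdiff : DifferentiableOn ℂ (fun w => ∑' n : ℕ, w ^ (n + 1) * d n) (Metric.ball 0 ρ) := by
    refine Complex.differentiableOn_tsum_of_summable_norm (u := fun n => ρ ^ n * C)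
      ((summable_geometric_of_lt_one hρ0 hρ).mul_right C) (fun n => by fun_prop)
      Metric.isOpen_ball fun n w hw => ?_
    rw [mem_ball_zero_iff] at hw
    rw [norm_mul, norm_pow]
    refine mul_le_mul ?_ (hd n) (norm_nonneg _) (by positivity)
    exact (pow_le_pow_of_le_one (norm_nonneg w) (hw.le.trans hρ.le) (Nat.le_succ n)).trans
      (pow_le_pow_left₀ (norm_nonneg w) hw.le n)
  have hzb : Metric.ball (0 : ℂ) ρ ∈ 𝓝 z := Metric.isOpen_ball.mem_nhds (by simpa using hzρ)
  refine DifferentiableAt.differentiableWithinAt ?_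
  refine (hdiff.differentiableAt hzb).congr_of_eventuallyEq ?_
  filter_upwards [hzb] with w hw
  rw [mem_ball_zero_iff] at hw
  exact (hf w (hw.trans hρ)).tsum_eq.symm

lemma fourierCoeff_of_hasSum {e : ℕ → ℤ} {s : ℕ → ℂ} (hs : Summable fun n => ‖s n‖)
    {g : C(Torus, ℂ)} (hg : ∀ t, HasSum (fun n => s n * fourier (e n) t) (g t)) (m : ℤ) :
    HasSum (fun n => s n * if m = e n then 1 else 0) (fourierCoeff g m) := by
  have h1 : Summable fun n => s n • (fourier (e n) : C(Torus, ℂ)) := by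
    refine Summable.of_norm_bounded hs fun n => ?_
    rw [norm_smul, fourier_norm, mul_one]
  have h2 : HasSum (fun n => s n • (fourier (e n) : C(Torus, ℂ))) g := by
    convert h1.hasSum
    ext t
    exact (hg t).unique (h1.hasSum.mapL (ContinuousMap.evalCLM ℂ t))
  have h3 := h2.mapL ((coeffL 1 m).comp (ContinuousMap.toLp 1 normLeb ℂ))
  have h4 : ∀ G : C(Torus, ℂ), (coeffL 1 m).comp (ContinuousMap.toLp 1 normLeb ℂ) G =
      fourierCoeff G m := fun G =>
    congrFun (fourierCoeff_congr_ae (ContinuousMap.coeFn_toLp (p := 1) (𝕜 := ℂ) normLeb G)) m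
  rw [h4 g] at h3
  refine (hasSum_iff_of_eq fun n => ?_).1 h3
  rw [map_smul, h4, fourierCoeff_fourier, Pi.single_apply, smul_eq_mul]

/-- If `f(z) = ∑ dₙ zⁿ⁺¹` satisfies `f(z) = f(r / z)` near one point of the annulus
`|r| < |z| < 1`, then `f = 0`: the identity holds on the whole annulus, and there the two sides are
Laurent series without common exponents. -/
theorem eq_zero_of_symmetric_powerSeries {d : ℕ → ℂ} {C : ℝ} (hd : ∀ n, ‖d n‖ ≤ C) {f : ℂ → ℂ}
    (hf : ∀ z, ‖z‖ < 1 → HasSum (fun n : ℕ => z ^ (n + 1) * d n) (f z)) {r z₀ : ℂ}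
    (hz₀ : ‖r‖ < ‖z₀‖ ∧ ‖z₀‖ < 1) (h : ∀ᶠ z in 𝓝 z₀, f z = f (r / z)) (n : ℕ) : d n = 0 := by
  have hfa := analyticOnNhd_of_hasSum hd hf
  set A := {z : ℂ | ‖r‖ < ‖z‖ ∧ ‖z‖ < 1} with hA
  have hA0 : ∀ z ∈ A, z ≠ 0 := fun z hz => norm_pos_iff.1 ((norm_nonneg r).trans_lt hz.1)
  have hAr : ∀ z ∈ A, ‖r / z‖ < 1 := fun z hz => by
    rw [norm_div, div_lt_one ((norm_nonneg r).trans_lt hz.1)]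
    exact hz.1
  have hfr : AnalyticOnNhd ℂ (fun z => f (r / z)) A := fun z hz =>
    AnalyticAt.fun_comp (f := fun z => r / z) (hfa _ (by simpa using hAr z hz))
      (analyticAt_const.div analyticAt_id (hA0 z hz))
  have heq : Set.EqOn f (fun z => f (r / z)) A :=
    AnalyticOnNhd.eqOn_of_preconnected_of_eventuallyEq
      (fun z hz => hfa z (by simpa using hz.2)) hfr
      (isPreconnected_annulus ‖r‖ (norm_nonneg r)) hz₀ h
  -- On the circle through `z₀` the two sides are trigonometric series with frequencies `n + 1` and
  -- `-(n + 1)`.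
  set z : Torus → ℂ := fun t => z₀ * fourier 1 t with hz
  have hnz : ∀ t, ‖z t‖ = ‖z₀‖ := fun t => by
    rw [hz, norm_mul, fourier_apply, Circle.norm_coe, mul_one]
  have hzA : ∀ t, z t ∈ A := fun t => by rw [hA, Set.mem_ofPred_eq, hnz]; exact hz₀
  have hpow : ∀ (t : Torus) (k : ℕ), (fourier 1 t : ℂ) ^ k = fourier (k : ℤ) t := fun t k => by
    rw [fourier_one, fourier_apply, natCast_zsmul, AddCircle.toCircle_nsmul, Circle.coe_pow]
  let g : C(Torus, ℂ) := ⟨fun t => f (z t), by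
    refine continuous_iff_continuousAt.2 fun t => ?_
    exact ContinuousAt.comp (f := z) (hfa (z t) (by simpa using (hzA t).2)).continuousAt
      (by fun_prop)⟩
  have hsum : ∀ w : ℂ, ‖w‖ < 1 → Summable fun n : ℕ => ‖w ^ (n + 1) * d n‖ := fun w hw =>
    (summable_smul_of_norm_le (summable_norm_pow hw) hd 1).norm
  have hg₁ : ∀ t, HasSum (fun n : ℕ => z₀ ^ (n + 1) * d n * fourier ((n : ℤ) + 1) t) (g t) := by
    intro t
    have e : g t = f (z t) := rfl
    rw [e]
    convert hf (z t) (hzA t).2 using 2 with n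
    rw [hz, mul_pow, hpow]
    push_cast
    ring
  have hg₂ : ∀ t, HasSum
      (fun n : ℕ => (r / z₀) ^ (n + 1) * d n * fourier (-((n : ℤ) + 1)) t) (g t) := by
    intro t
    have e : g t = f (r / z t) := heq (hzA t)
    rw [e]
    convert hf (r / z t) (hAr _ (hzA t)) using 2 with n
    have h1 : (fourier (-((n : ℤ) + 1)) t : ℂ) = ((fourier 1 t : ℂ)⁻¹) ^ (n + 1) := by
      rw [inv_pow, hpow, fourier_apply, fourier_apply, neg_smul, AddCircle.toCircle_neg,
        Circle.coe_inv]
      push_cast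
      rfl
    rw [hz, h1, ← div_div, div_eq_mul_inv (r / z₀), mul_pow]
    ring
  have c₁ := (fourierCoeff_of_hasSum (hsum z₀ hz₀.2) hg₁ (n + 1)).unique
    (hasSum_single n fun k hk => by rw [if_neg (by omega), mul_zero])
  have c₂ := (fourierCoeff_of_hasSum (hsum (r / z₀) (hAr z₀ hz₀)) hg₂ (n + 1)).unique
    (by
      have : ∀ k : ℕ, (r / z₀) ^ (k + 1) * d k *
          (if (n : ℤ) + 1 = -((k : ℤ) + 1) then (1 : ℂ) else 0) = 0 := fun k => by
        rw [if_neg (by omega), mul_zero]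
      simp only [this]
      exact hasSum_zero)
  rw [c₂, if_pos rfl, mul_one] at c₁
  exact (mul_eq_zero.1 c₁.symm).resolve_left (pow_ne_zero _ (hA0 z₀ hz₀))

/-! ### Hypercyclicity -/

/-- The eigenvectors with eigenvalue in a nonempty open subset of the interior of the ellipse span a
dense subspace. -/
theorem dense_span_eigenvectors (p : ℝ≥0∞) [Fact (1 ≤ p)] [Fact (p ≠ ∞)] {a b c : ℂ}
    (hac : ‖c‖ < ‖a‖) {U : Set ℂ} (hU : IsOpen U) (hne : U.Nonempty)
    (hUE : ∀ l ∈ U, ‖ellipseForm a c (l - b)‖ < ‖a‖ ^ 2 - ‖c‖ ^ 2) :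
    Dense (Submodule.span ℂ {u : hardySpace p | ∃ l ∈ U, toeplitzElliptic p a b c u = l • u} :
      Set (hardySpace p)) := by
  have ha : a ≠ 0 := norm_pos_iff.1 ((norm_nonneg c).trans_lt hac)
  refine dense_span_of_annihilator fun φ hφ => functional_eq_zero_of_monomial p φ fun n => ?_
  -- For `l ≠ b` the two roots do not both vanish.
  obtain ⟨l, hlU, hlb⟩ : ∃ l ∈ U, l ≠ b := by
    obtain ⟨l, hlU, hl⟩ := (dense_compl_singleton b).inter_open_nonempty U hU hne
    exact ⟨l, hlU, hl⟩
  obtain ⟨x, y, hl, hc, hx0⟩ : ∃ x y : ℂ, a * (x + y) = l - b ∧ a * (x * y) = c ∧ x ≠ 0 := by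
    obtain ⟨x, y, hl, hc⟩ := exists_roots ha (l - b) c
    by_cases hx : x = 0
    · refine ⟨y, x, by rw [← hl]; ring, by rw [← hc]; ring, fun hy => hlb ?_⟩
      rw [hx, hy, add_zero, mul_zero] at hl
      exact sub_eq_zero.1 hl.symm
    · exact ⟨x, y, hl, hc, hx⟩
  obtain ⟨hx, hy⟩ := roots_norm_lt_one hac hl hc (hUE l hlU)
  have hr : c / a = x * y := by rw [← hc]; field_simp
  have hrx : ‖x * y‖ < ‖x‖ := by
    rw [norm_mul]
    exact mul_lt_of_lt_one_right (norm_pos_iff.2 hx0) hy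
  have hdn : ∀ n, ‖φ (monomial p n)‖ ≤ ‖φ‖ := fun n =>
    by
    simpa only [mul_one] using φ.le_opNorm_of_le (norm_monomial_le p n)
  refine eq_zero_of_symmetric_powerSeries hdn
    (fun z hz => hasSum_functional_kernelVector p hz φ) (r := x * y) (z₀ := x) ⟨hrx, hx⟩ ?_ n
  have hcont : ContinuousAt (fun z => b + a * (z + x * y / z)) x := by
    fun_prop (disch := exact hx0)
  have hval : b + a * (x + x * y / x) = l := by
    rw [mul_div_cancel_left₀ y hx0, hl]; ring
  have e1 : ∀ᶠ z in 𝓝 x, b + a * (z + x * y / z) ∈ U :=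
    hcont.eventually_mem (by rw [hval]; exact hU.mem_nhds hlU)
  have e2 : ∀ᶠ z in 𝓝 x, ‖x * y‖ < ‖z‖ :=
    continuous_norm.continuousAt.eventually (lt_mem_nhds hrx)
  have e3 : ∀ᶠ z in 𝓝 x, ‖z‖ < 1 := continuous_norm.continuousAt.eventually (gt_mem_nhds hx)
  filter_upwards [e1, e2, e3] with z h1 h2 h3
  have hz0 : z ≠ 0 := norm_pos_iff.1 ((norm_nonneg _).trans_lt h2)
  have h4 : ‖x * y / z‖ < 1 := by
    rw [norm_div, div_lt_one (norm_pos_iff.2 hz0)]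
    exact h2
  have := hφ _ ⟨_, h1, toeplitzElliptic_kernelVector_sub p b h3 h4 (c := c)
    (by rw [mul_div_cancel₀ _ hz0, hc])⟩
  rwa [map_sub, sub_eq_zero] at this

theorem isHypercyclic_toeplitzElliptic (p : ℝ≥0∞) [Fact (1 ≤ p)] [Fact (p ≠ ∞)] {a b c : ℂ}
    (hac : ‖c‖ < ‖a‖)
    (h : (curveInterior (Set.range (ellipticSymbol a b c)) ∩ Metric.sphere (0 : ℂ) 1).Nonempty) :
    IsHypercyclic (toeplitzElliptic p a b c) := by
  rw [curveInterior_ellipticSymbol hac] at h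
  obtain ⟨l, hl, hl1⟩ := h
  rw [mem_sphere_zero_iff_norm] at hl1
  have hEo := isOpen_ellipse a b c (‖a‖ ^ 2 - ‖c‖ ^ 2)
  have hlim : Tendsto (fun s : ℝ => s • l) (𝓝 1) (𝓝 l) := by
    have : Continuous fun s : ℝ => s • l := by fun_prop
    simpa using this.tendsto 1
  have hev := hlim.eventually (hEo.mem_nhds hl)
  have hns : ∀ s : ℝ, 0 < s → ‖s • l‖ = s := fun s hs => by
    rw [norm_smul, hl1, mul_one, Real.norm_of_nonneg hs.le]
  have : CompleteSpace (hardySpace p) := (isClosed_hardySpace p).completeSpace_coe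
  have : SecondCountableTopology (hardySpace p) :=
    inferInstanceAs (SecondCountableTopology (hardySpace p : Set (Lp ℂ p normLeb)))
  refine isHypercyclic_of_eigenvectors (toeplitzElliptic p a b c)
    (fun x hx => ?_) (fun x hx => ?_)
    (dense_span_eigenvectors p (b := b) hac (hEo.inter (isOpen_lt continuous_norm continuous_const))
      (?_ : (_ ∩ {z : ℂ | ‖z‖ < 1}).Nonempty) fun l hl => hl.1)
    (dense_span_eigenvectors p (b := b) hac (hEo.inter (isOpen_lt continuous_const continuous_norm))
      (?_ : (_ ∩ {z : ℂ | 1 < ‖z‖}).Nonempty) fun l hl => hl.1)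
  · obtain ⟨l, hl, h⟩ := hx
    exact ⟨l, hl.2, h⟩
  · obtain ⟨l, hl, h⟩ := hx
    exact ⟨l, hl.2, h⟩
  · obtain ⟨s, ⟨hs, hs0⟩, hs1⟩ := (((hev.and (lt_mem_nhds one_pos)).filter_mono
      (nhdsWithin_le_nhds (s := Set.Iio 1))).and self_mem_nhdsWithin).exists
    exact ⟨s • l, hs, by rw [Set.mem_ofPred_eq, hns s hs0]; exact hs1⟩
  · obtain ⟨s, hs, hs1⟩ := ((hev.filter_mono
      (nhdsWithin_le_nhds (s := Set.Ioi 1))).and self_mem_nhdsWithin).exists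
    exact ⟨s • l, hs, by rw [Set.mem_ofPred_eq, hns s (one_pos.trans hs1)]; exact hs1⟩

end HardyToeplitz

theorem mainTheorem10 (p : ENNReal) [Fact (1 ≤ p)] (hp₁ : 1 < p) (hp₂ : p ≠ ⊤)
    (a b c : ℂ) (hac : ‖a‖ ≠ ‖c‖) :
    HardyToeplitz.IsHypercyclic (HardyToeplitz.toeplitzElliptic p a b c) ↔
      ‖c‖ < ‖a‖ ∧
        (HardyToeplitz.curveInterior (Set.range (HardyToeplitz.ellipticSymbol a b c)) ∩
          Metric.sphere (0 : ℂ) 1).Nonempty := by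
  have : Fact (p ≠ ⊤) := ⟨hp₂⟩
  constructor
  · intro h
    have hca : ‖c‖ < ‖a‖ := by
      by_contra hle
      exact HardyToeplitz.not_isHypercyclic_of_norm_lt p b
        (lt_of_le_of_ne (not_lt.1 hle) hac) h
    refine ⟨hca, ?_⟩
    by_contra hE
    rcases HardyToeplitz.ellipse_dichotomy hca b hE with h1 | ⟨h1, h0⟩
    · exact HardyToeplitz.not_isHypercyclic_of_symbol_le_one p hca h1 h
    · exact HardyToeplitz.not_isHypercyclic_of_one_le_symbol p hca h1 h0 h
  · rintro ⟨hca, hE⟩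
    exact HardyToeplitz.isHypercyclic_toeplitzElliptic p hca hE
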